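/- **Setting.** All categories below are finite semisimple C*-categories (C*-categories with finite orthogonal direct sums and finitely many isomorphism classes of simple objects, in which every object is a finite orthogonal direct sum of simples); a $*$-linear functor is *bi-faithful* if it and its adjoint are faithful, and we use the same letter for a functor $F:\mathcal C\to\mathcal D$ and for its adjacency matrix $F_{w,v}=\dim \mathcal D(w,Fv)$ ($v$, $w$ simple). A *0-cell* $(\Gamma_\bullet,\underline\mu^\bullet)$ is a sequence of bi-faithful $*$-linear functors $\Gamma_k:\mathcal M_{k-1}\to\mathcal M_k$ ($k\ge 1$) with positive weights $\underline\mu^k=(\mu^k_v)$ on the simple objects of $\mathcal M_k$ such that $\sum_v\mu^0_v=1$ and $\Gamma_k'\underline\mu^k=\underline\mu^{k-1}$ for $k\ge1$. A *1-cell* $\Lambda_\bullet$ from $(\Gamma_\bullet,\underline\mu^\bullet)$ to $(\Delta_\bullet,\underline\nu^\bullet)$ (with categories $\mathcal N_k$) consists of bi-faithful $*$-linear functors $\Lambda_k:\mathcal M_k\to\mathcal N_k$ ($k\ge0$) and natural unitaries $W_k:\Delta_k\Lambda_{k-1}\to\Lambda_k\Gamma_k$ ($k\ge1$) such that for some $\epsilon,M>0$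 one has $\epsilon\mu^k_v\le[\Lambda_k'\underline\nu^k]_v\le M\mu^k_v$ for all $k$ and all simple $v$ of $\mathcal M_k$. For 1-cells $\Lambda_\bullet,\Omega_\bullet$ from $(\Gamma_\bullet,\underline\mu^\bullet)$ to $(\Delta_\bullet,\underline\nu^\bullet)$, the *loop operator* $S_k:\mathrm{NT}(\Lambda_k,\Omega_k)\to\mathrm{NT}(\Lambda_{k-1},\Omega_{k-1})$ is $$(S_k\eta)_x=(\rho'_{\Omega_{k-1}x})^*\circ\Delta_k'\big((W^\Omega_k)_x^*\circ\eta_{\Gamma_kx}\circ (W^\Lambda_k)_x\big)\circ\rho'_{\Lambda_{k-1}x},$$ where $(\Delta_k',\rho:\mathrm{id}\to\Delta_k\Delta_k',\rho':\mathrm{id}\to\Delta_k'\Delta_k)$ is a solution of the conjugate equations which is tracial and commensurate with $(\underline\nu^{k-1},\underline\nu^k)$: $(\rho'_v)^*\Delta_k'(\sigma\tau^*)\rho'_v\cdot\nu^{k-1}_v=\nu^k_w\langle\sigma,\tau\rangle 1_v$ for simple $v,w$ and $\sigma,\tau:w\to\Delta_kv$, with $\tau^*\sigma=\langle\sigma,\tau\rangle1_w$.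 A *bounded quasi-flat sequence (BQFS)* from $\Lambda_\bullet$ to $\Omega_\bullet$ is a sequence $\underline\eta=\{\eta^{(k)}\in\mathrm{NT}(\Lambda_k,\Omega_k)\}_{k\ge0}$ with $S_{k+1}\eta^{(k+1)}=\eta^{(k)}$ for all $k\ge0$ and $\sup_k\|\eta^{(k)}\|<\infty$ (C*-norm). Let $m_0$ (resp. $n_0$) be the direct sum of the simple objects of $\mathcal M_0$ (resp. $\mathcal N_0$), $A_k=\mathrm{End}(\Gamma_k\cdots\Gamma_1m_0)$, $A_\infty=\bigcup_kA_k$ with the tracial state $\mathrm{Tr}$ given by the weights, and $A=\mathcal{PB}(\Gamma_\bullet)=A_\infty''$ on $L^2(A_\infty,\mathrm{Tr})$; $B_k,B_\infty,B$ are defined in the same way from $(\Delta_\bullet,\underline\nu^\bullet)$. $\mathcal{PB}(\Lambda_\bullet)$ is the $A$-$B$-bimodule $H$ obtained by completing $\bigcup_kH_k$, $H_k=\mathcal N_k(\Delta_k\cdots\Delta_1n_0,\Lambda_k\Gamma_k\cdots\Gamma_1m_0)$, with inclusions $\xi\mapsto W_{k+1}\circ\Delta_{k+1}\xi$ and inner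 product $\langle\xi,\zeta\rangle=\mathrm{Tr}(\zeta^*\xi)$; the actions are the normal extensions of $\alpha\cdot\xi\cdot\beta=\Lambda_k(\alpha)\circ\xi\circ\beta$ ($\alpha\in A_k,\ \beta\in B_k,\ \xi\in H_k$). For $\gamma:\Lambda_k\Gamma_k\cdots\Gamma_1m_0\to\Omega_k\Gamma_k\cdots\Gamma_1m_0$, let $\Phi_\gamma:\mathcal{PB}(\Lambda_\bullet)\to\mathcal{PB}(\Omega_\bullet)$ be the bounded operator given on $H_{k+l}$ by composition with $\gamma^{(l)}$, where $\gamma^{(0)}=\gamma$ and $\gamma^{(l+1)}=W^\Omega_{k+l+1}\circ\Delta_{k+l+1}\gamma^{(l)}\circ (W^{\Lambda}_{k+l+1})^*$. For a BQFS $\underline\eta$ put $\mathcal{PB}(\underline\eta)=\text{SOT-}\lim_k\Phi_{\eta^{(k)}_{\Gamma_k\cdots\Gamma_1m_0}}$. **Proposition.** Let $\Lambda_\bullet,\Omega_\bullet,\Xi_\bullet$ be 1-cells from $(\Gamma_\bullet,\underline\mu^\bullet)$ to $(\Delta_\bullet,\underline\nu^\bullet)$, let $\underline\eta$ be a BQFS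 from $\Lambda_\bullet$ to $\Omega_\bullet$ and $\underline\kappa$ a BQFS from $\Omega_\bullet$ to $\Xi_\bullet$. Then: (a) for every $k\ge0$ the sequence $\{S_{k+1}\cdots S_{k+l}(\kappa^{(k+l)}\circ\eta^{(k+l)})\}_{l\ge0}$ converges in $\mathrm{NT}(\Lambda_k,\Xi_k)$, and the limits $(\underline\kappa\cdot\underline\eta)^{(k)}$ form a BQFS $\underline\kappa\cdot\underline\eta$ from $\Lambda_\bullet$ to $\Xi_\bullet$; (b) the strong limits defining $\mathcal{PB}(\underline\eta)$, $\mathcal{PB}(\underline\kappa)$, $\mathcal{PB}(\underline\kappa\cdot\underline\eta)$ exist and are bounded $A$-$B$-bimodule maps, and $\mathcal{PB}(\underline\kappa\cdot\underline\eta)=\mathcal{PB}(\underline\kappa)\circ\mathcal{PB}(\underline\eta)$. -/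

import Mathlib

open CategoryTheory

universe v u v₁ u₁ v₂ u₂

noncomputable section

/-- A C*-category: a complex Banach category with an involution `dag` on morphisms satisfying the
C*-identity and such that `f† ∘ f` is a positive element of the endomorphism algebra of the
source. -/
class CStarCategory (C : Type u) extends Category.{v} C where
  homNormed : ∀ X Y : C, NormedAddCommGroup (X ⟶ Y)
  homSpace : ∀ X Y : C, NormedSpace ℂ (X ⟶ Y)
  homComplete : ∀ X Y : C, CompleteSpace (X ⟶ Y)
  add_comp' : ∀ {X Y Z : C} (f g : X ⟶ Y) (h : Y ⟶ Z), (f + g) ≫ h = f ≫ h + g ≫ h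
  comp_add' : ∀ {X Y Z : C} (f : X ⟶ Y) (g h : Y ⟶ Z), f ≫ (g + h) = f ≫ g + f ≫ h
  smul_comp' : ∀ {X Y Z : C} (r : ℂ) (f : X ⟶ Y) (g : Y ⟶ Z), (r • f) ≫ g = r • (f ≫ g)
  comp_smul' : ∀ {X Y Z : C} (f : X ⟶ Y) (r : ℂ) (g : Y ⟶ Z), f ≫ (r • g) = r • (f ≫ g)
  dag : ∀ {X Y : C}, (X ⟶ Y) → (Y ⟶ X)
  dag_dag : ∀ {X Y : C} (f : X ⟶ Y), dag (dag f) = f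
  dag_add : ∀ {X Y : C} (f g : X ⟶ Y), dag (f + g) = dag f + dag g
  dag_smul : ∀ {X Y : C} (r : ℂ) (f : X ⟶ Y), dag (r • f) = (starRingEnd ℂ r) • dag f
  dag_comp : ∀ {X Y Z : C} (f : X ⟶ Y) (g : Y ⟶ Z), dag (f ≫ g) = dag g ≫ dag f
  norm_comp_le : ∀ {X Y Z : C} (f : X ⟶ Y) (g : Y ⟶ Z), ‖f ≫ g‖ ≤ ‖f‖ * ‖g‖
  norm_comp_dag : ∀ {X Y : C} (f : X ⟶ Y), ‖f ≫ dag f‖ = ‖f‖ * ‖f‖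
  comp_dag_pos : ∀ {X Y : C} (f : X ⟶ Y), ∃ g : X ⟶ X, f ≫ dag f = g ≫ dag g

attribute [reducible, instance] CStarCategory.homNormed CStarCategory.homSpace
attribute [instance] CStarCategory.homComplete

namespace CStarCategory

variable {C : Type u} [CStarCategory.{v} C]

instance : Preadditive C where
  homGroup X Y := inferInstance
  add_comp _ _ _ f g h := add_comp' f g h
  comp_add _ _ _ f g h := comp_add' f g h

instance : Linear ℂ C where
  homModule X Y := inferInstance
  smul_comp _ _ _ r f g := smul_comp' r f g
  comp_smul _ _ _ f r g := comp_smul' f r g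

theorem dag_id (X : C) : dag (𝟙 X) = 𝟙 X := by
  have h := dag_comp (dag (𝟙 X)) (𝟙 X)
  rw [Category.comp_id, dag_dag] at h
  rw [Category.comp_id] at h
  exact h.symm

theorem dag_zero {X Y : C} : dag (0 : X ⟶ Y) = 0 := by
  have h := dag_smul (0 : ℂ) (0 : X ⟶ Y)
  simpa using h

theorem dag_sum {X Y : C} {ι : Type*} (s : Finset ι) (f : ι → (X ⟶ Y)) :
    dag (∑ i ∈ s, f i) = ∑ i ∈ s, dag (f i) :=
  map_sum (⟨⟨dag, dag_zero⟩, dag_add⟩ : (X ⟶ Y) →+ (Y ⟶ X)) f s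

theorem norm_dag {X Y : C} (f : X ⟶ Y) : ‖dag f‖ = ‖f‖ := by
  have key : ∀ {X Y : C} (f : X ⟶ Y), ‖f‖ ≤ ‖dag f‖ := by
    intro X Y f
    have h1 : ‖f‖ * ‖f‖ ≤ ‖f‖ * ‖dag f‖ := by
      rw [← norm_comp_dag f]; exact norm_comp_le _ _
    rcases (norm_nonneg f).eq_or_lt with h | h
    · rw [← h]; exact norm_nonneg _
    · exact le_of_mul_le_mul_left h1 h
  refine le_antisymm ?_ (key f)
  simpa [dag_dag] using key (dag f)

/-- An isometry has norm at most one. -/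
theorem norm_le_one_of_isometry {X Y : C} (f : X ⟶ Y) (h : f ≫ dag f = 𝟙 X) : ‖f‖ ≤ 1 := by
  have h1 : ‖𝟙 X‖ = ‖𝟙 X‖ * ‖𝟙 X‖ := by
    have := norm_comp_dag (𝟙 X)
    rwa [dag_id, Category.comp_id] at this
  have h2 := norm_comp_dag f
  rw [h] at h2
  by_contra hc
  push Not at hc
  rcases eq_or_ne ‖𝟙 X‖ 0 with h0 | h0
  · rw [h0] at h2; nlinarith
  · have : ‖𝟙 X‖ = 1 := by
      have := mul_left_cancel₀ h0 (h1.symm.trans (mul_one _).symm)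
      exact this
    rw [this] at h2; nlinarith

end CStarCategory

open CStarCategory

/-- A C*-category with finitely many isomorphism classes of simple objects in which every object
is a finite orthogonal direct sum of simple objects. -/
class SemisimpleCStarCategory (C : Type u) extends CStarCategory.{v} C where
  /-- a maximal family of mutually non-isomorphic simple objects, indexed by a finite set -/
  V : Type
  vFintype : Fintype V
  simple : V → C
  simple_end : ∀ (v : V) (f : simple v ⟶ simple v), ∃ c : ℂ, f = c • 𝟙 (simple v)
  simple_ne_zero : ∀ v : V, 𝟙 (simple v) ≠ 0
  simple_hom : ∀ (v w : V), v ≠ w → ∀ f : simple v ⟶ simple w, f = 0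
  /-- orthonormal bases: `1_X = ∑_v ∑_{σ ∈ ONB(v, X)} σ σ†` -/
  exists_onb : ∀ X : C, ∃ (n : V → ℕ) (σ : ∀ v, Fin (n v) → (simple v ⟶ X)),
    (∀ v a b, σ v a ≫ dag (σ v b) = if a = b then 𝟙 (simple v) else 0) ∧
    ∑ v, ∑ a, dag (σ v a) ≫ σ v a = 𝟙 X
  /-- finite orthogonal direct sums -/
  exists_sum : ∀ (J : Type) [Fintype J] (X : J → C), ∃ (S : C) (ι : ∀ i, X i ⟶ S),
    (∀ i, ι i ≫ dag (ι i) = 𝟙 (X i)) ∧ (∀ i j, i ≠ j → ι i ≫ dag (ι j) = 0) ∧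
    ∑ i, dag (ι i) ≫ ι i = 𝟙 S

attribute [reducible, instance] SemisimpleCStarCategory.vFintype


namespace SemisimpleCStarCategory

variable {C : Type u} [SemisimpleCStarCategory.{v} C]

/-- The scalar `c` with `f = c • 1`, for an endomorphism `f` of a simple object. -/
def scal {v : V C} (f : simple v ⟶ simple v) : ℂ := (simple_end v f).choose

theorem scal_spec {v : V C} (f : simple v ⟶ simple v) : f = scal f • 𝟙 (simple v) :=
  (simple_end v f).choose_spec

theorem scal_eq {v : V C} {f : simple v ⟶ simple v} {c : ℂ} (h : f = c • 𝟙 (simple v)) :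
    scal f = c :=
  smul_left_injective ℂ (simple_ne_zero v) ((scal_spec f).symm.trans h)

theorem scal_id (v : V C) : scal (𝟙 (simple v)) = 1 := scal_eq (one_smul _ _).symm

theorem scal_add {v : V C} (f g : simple v ⟶ simple v) : scal (f + g) = scal f + scal g :=
  scal_eq (by rw [add_smul, ← scal_spec, ← scal_spec])

theorem scal_smul {v : V C} (r : ℂ) (f : simple v ⟶ simple v) : scal (r • f) = r * scal f :=
  scal_eq (by rw [mul_smul, ← scal_spec])

theorem scal_zero {v : V C} : scal (0 : simple v ⟶ simple v) = 0 := scal_eq (zero_smul _ _).symm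

theorem scal_sum {v : V C} {ι : Type*} (s : Finset ι) (f : ι → (simple v ⟶ simple v)) :
    scal (∑ i ∈ s, f i) = ∑ i ∈ s, scal (f i) :=
  map_sum (⟨⟨scal, scal_zero⟩, scal_add⟩ : (simple v ⟶ simple v) →+ ℂ) f s

theorem scal_comp {v : V C} (f g : simple v ⟶ simple v) : scal (f ≫ g) = scal f * scal g :=
  scal_eq (by
    conv_lhs => rw [scal_spec f, scal_spec g]
    rw [Linear.smul_comp, Category.id_comp, smul_smul])

theorem scal_dag {v : V C} (f : simple v ⟶ simple v) :
    scal (dag f) = starRingEnd ℂ (scal f) :=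
  scal_eq (by conv_lhs => rw [scal_spec f, dag_smul, dag_id])

theorem norm_id_simple (v : V C) : ‖𝟙 (simple v)‖ = 1 := by
  have := norm_comp_dag (𝟙 (simple v))
  rw [dag_id, Category.comp_id] at this
  have h0 : ‖𝟙 (simple v)‖ ≠ 0 := norm_ne_zero_iff.2 (simple_ne_zero v)
  exact (mul_left_cancel₀ h0 ((mul_one _).trans this)).symm

theorem scal_comp_dag {v : V C} {X : C} (f : simple v ⟶ X) :
    scal (f ≫ dag f) = ((‖f‖ ^ 2 : ℝ) : ℂ) := by
  obtain ⟨g, hg⟩ := comp_dag_pos f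
  have h1 : scal (f ≫ dag f) = ((‖scal g‖ ^ 2 : ℝ) : ℂ) := by
    rw [hg, scal_comp, scal_dag, Complex.mul_conj, Complex.normSq_eq_norm_sq]
  have h2 : ‖f ≫ dag f‖ = ‖scal g‖ ^ 2 := by
    rw [scal_spec (f ≫ dag f), h1, norm_smul, norm_id_simple, mul_one, Complex.norm_real]
    simp
  rw [h1, ← h2, norm_comp_dag, sq]

/-- The number of elements of the chosen orthonormal basis of `Hom(v, X)`. -/
def onbCard (X : C) : V C → ℕ := (exists_onb X).choose

/-- A chosen orthonormal basis of `Hom(v, X)` for the inner product `⟨σ, τ⟩ 1_v = τ† ∘ σ`. -/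
def onb (X : C) : ∀ v : V C, Fin (onbCard X v) → (simple v ⟶ X) :=
  (exists_onb X).choose_spec.choose

theorem onb_orth (X : C) (v : V C) (a b : Fin (onbCard X v)) :
    onb X v a ≫ dag (onb X v b) = if a = b then 𝟙 (simple v) else 0 :=
  (exists_onb X).choose_spec.choose_spec.1 v a b

theorem onb_sum (X : C) : ∑ v, ∑ a, dag (onb X v a) ≫ onb X v a = 𝟙 X :=
  (exists_onb X).choose_spec.choose_spec.2

/-- The categorical trace associated to a weight function `μ`:
`Tr_X(α) = ∑_v ∑_{σ ∈ ONB(v, X)} μ_v ⟨α σ, σ⟩`. -/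
def catTr (μ : V C → ℝ) (X : C) (α : X ⟶ X) : ℂ :=
  ∑ v, ∑ a, (μ v : ℂ) * scal (onb X v a ≫ α ≫ dag (onb X v a))

variable (μ : V C → ℝ)

theorem catTr_add (X : C) (α β : X ⟶ X) : catTr μ X (α + β) = catTr μ X α + catTr μ X β := by
  simp only [catTr, Preadditive.add_comp, Preadditive.comp_add, scal_add, mul_add,
    Finset.sum_add_distrib]

theorem catTr_smul (X : C) (r : ℂ) (α : X ⟶ X) : catTr μ X (r • α) = r * catTr μ X α := by
  simp only [catTr, Linear.smul_comp, Linear.comp_smul, scal_smul, Finset.mul_sum]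
  refine Finset.sum_congr rfl fun v _ => Finset.sum_congr rfl fun a _ => ?_
  ring

theorem catTr_sum (X : C) {ι : Type*} (s : Finset ι) (f : ι → (X ⟶ X)) :
    catTr μ X (∑ i ∈ s, f i) = ∑ i ∈ s, catTr μ X (f i) :=
  map_sum (⟨⟨catTr μ X, by simpa using catTr_smul μ X 0 0⟩, catTr_add μ X⟩ : (X ⟶ X) →+ ℂ) f s

theorem catTr_dag (X : C) (α : X ⟶ X) :
    catTr μ X (dag α) = starRingEnd ℂ (catTr μ X α) := by
  simp only [catTr, map_sum, map_mul, Complex.conj_ofReal]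
  refine Finset.sum_congr rfl fun v _ => Finset.sum_congr rfl fun a _ => ?_
  rw [← scal_dag, dag_comp, dag_comp, dag_dag, Category.assoc]

theorem catTr_pos (X : C) {Y : C} (f : X ⟶ Y) :
    catTr μ X (f ≫ dag f) = ((∑ v, ∑ a, μ v * ‖onb X v a ≫ f‖ ^ 2 : ℝ) : ℂ) := by
  rw [catTr]
  push_cast
  refine Finset.sum_congr rfl fun v _ => Finset.sum_congr rfl fun a _ => ?_
  have := scal_comp_dag (onb X v a ≫ f)
  rw [dag_comp, Category.assoc] at this
  rw [Category.assoc, this]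
  push_cast
  rfl

theorem scal_insert {v : V C} {X : C} (f : simple v ⟶ X) (g : X ⟶ simple v) :
    scal (f ≫ g) = ∑ b, scal (f ≫ dag (onb X v b)) * scal (onb X v b ≫ g) := by
  classical
  conv_lhs => rw [← Category.comp_id f, ← onb_sum X]
  rw [Preadditive.comp_sum, Preadditive.sum_comp, scal_sum, Finset.sum_eq_single v]
  · rw [Preadditive.comp_sum, Preadditive.sum_comp, scal_sum]
    refine Finset.sum_congr rfl fun b _ => ?_
    rw [← scal_comp]
    simp only [Category.assoc]
  · intro w _ hw
    rw [Preadditive.comp_sum, Preadditive.sum_comp, scal_sum]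
    refine Finset.sum_eq_zero fun b _ => ?_
    rw [← Category.assoc f, simple_hom v w hw.symm (f ≫ dag (onb X w b))]
    simp only [Limits.zero_comp]
    exact scal_zero
  · simp

theorem catTr_comm {X Y : C} (f : X ⟶ Y) (g : Y ⟶ X) :
    catTr μ X (f ≫ g) = catTr μ Y (g ≫ f) := by
  have e : ∀ {X Y : C} (f : X ⟶ Y) (g : Y ⟶ X), catTr μ X (f ≫ g) = ∑ v, ∑ a, ∑ b,
      (μ v : ℂ) * (scal (onb X v a ≫ f ≫ dag (onb Y v b)) *
        scal (onb Y v b ≫ g ≫ dag (onb X v a))) := by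
    intro X Y f g
    refine Finset.sum_congr rfl fun v _ => Finset.sum_congr rfl fun a _ => ?_
    have := scal_insert (onb X v a ≫ f) (g ≫ dag (onb X v a))
    simp only [Category.assoc] at this
    rw [Category.assoc, this, Finset.mul_sum]
  rw [e, e]
  refine Finset.sum_congr rfl fun v _ => ?_
  rw [Finset.sum_comm]
  refine Finset.sum_congr rfl fun b _ => Finset.sum_congr rfl fun a _ => ?_
  ring

theorem onbCard_eq_finrank (X : C) (v : V C) :
    onbCard X v = Module.finrank ℂ (simple v ⟶ X) := by
  classical
  let e : (simple v ⟶ X) ≃ₗ[ℂ] (Fin (onbCard X v) → ℂ) :=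
    { toFun := fun f b => scal (f ≫ dag (onb X v b))
      map_add' := fun f g => by
        funext b; simp only [Preadditive.add_comp, scal_add, Pi.add_apply]
      map_smul' := fun r f => by
        funext b; simp only [Linear.smul_comp, scal_smul, Pi.smul_apply, smul_eq_mul]; rfl
      invFun := fun c => ∑ b, c b • onb X v b
      left_inv := fun f => by
        conv_rhs => rw [← Category.comp_id f, ← onb_sum X]
        rw [Preadditive.comp_sum, Finset.sum_eq_single v]
        · rw [Preadditive.comp_sum]
          refine Finset.sum_congr rfl fun b _ => ?_
          conv_rhs => rw [← Category.assoc, scal_spec (f ≫ dag (onb X v b))]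
          rw [Linear.smul_comp, Category.id_comp]
        · intro w _ hw
          rw [Preadditive.comp_sum]
          refine Finset.sum_eq_zero fun b _ => ?_
          rw [← Category.assoc f, simple_hom v w hw.symm (f ≫ dag (onb X w b))]
          exact Limits.zero_comp
        · simp
      right_inv := fun c => by
        funext b
        simp only [Preadditive.sum_comp, scal_sum, Linear.smul_comp, scal_smul, onb_orth]
        rw [Finset.sum_eq_single b]
        · simp [scal_id]
        · intro a _ hab
          simp [hab, scal_zero]
        · simp }
  rw [e.finrank_eq]
  simp

/-- `Hom(X, Y)` with the scalar product `⟨x, y⟩ = Tr_X(x† ∘ y)`. -/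
def homCore (hμ : ∀ v, 0 < μ v) (X Y : C) : PreInnerProductSpace.Core ℂ (X ⟶ Y) where
  inner x y := catTr μ X (y ≫ dag x)
  conj_inner_symm x y := by
    rw [← catTr_dag, dag_comp, dag_dag]
  re_inner_nonneg x := by
    rw [catTr_pos]
    simp only [RCLike.re_to_complex, Complex.ofReal_re]
    exact Finset.sum_nonneg fun v _ => Finset.sum_nonneg fun a _ =>
      mul_nonneg (hμ v).le (sq_nonneg _)
  add_left x y z := by
    rw [dag_add, Preadditive.comp_add, catTr_add]
  smul_left x y r := by
    rw [dag_smul, Linear.comp_smul, catTr_smul]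

theorem catTr_comp_le (hμ : ∀ v, 0 < μ v) {X Y Z : C} (f : X ⟶ Y) (g : Y ⟶ Z) :
    (catTr μ X ((f ≫ g) ≫ dag (f ≫ g))).re ≤ ‖g‖ ^ 2 * (catTr μ X (f ≫ dag f)).re := by
  rw [catTr_pos, catTr_pos, Complex.ofReal_re, Complex.ofReal_re, Finset.mul_sum]
  refine Finset.sum_le_sum fun v _ => ?_
  rw [Finset.mul_sum]
  refine Finset.sum_le_sum fun a _ => ?_
  rw [← Category.assoc]
  have h := norm_comp_le (onb X v a ≫ f) g
  have h2 : ‖(onb X v a ≫ f) ≫ g‖ ^ 2 ≤ (‖onb X v a ≫ f‖ * ‖g‖) ^ 2 := by gcongr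
  have := mul_le_mul_of_nonneg_left h2 (hμ v).le
  nlinarith

theorem catTr_comp_le' (hμ : ∀ v, 0 < μ v) {X Y Z : C} (f : X ⟶ Y) (g : Y ⟶ Z) :
    (catTr μ X ((f ≫ g) ≫ dag (f ≫ g))).re ≤ ‖f‖ ^ 2 * (catTr μ Y (g ≫ dag g)).re := by
  have h := catTr_comp_le μ hμ (dag g) (dag f)
  rw [← dag_comp, dag_dag, dag_dag, norm_dag] at h
  rwa [catTr_comm μ (f ≫ g), catTr_comm μ g]

end SemisimpleCStarCategory

open SemisimpleCStarCategory

/-- A `*`-linear functor between C*-categories. -/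
structure StarFunctor (C : Type u₁) [CStarCategory.{v₁} C] (D : Type u₂) [CStarCategory.{v₂} D]
    extends C ⥤ D where
  map_add' : ∀ {X Y : C} (f g : X ⟶ Y), map (f + g) = map f + map g
  map_smul' : ∀ {X Y : C} (r : ℂ) (f : X ⟶ Y), map (r • f) = r • map f
  map_dag : ∀ {X Y : C} (f : X ⟶ Y), map (dag f) = dag (map f)

/-- A functor is bi-faithful if it is faithful and has a faithful adjoint. -/
def BiFaithful {C : Type u₁} [Category.{v₁} C] {D : Type u₂} [Category.{v₂} D] (F : C ⥤ D) :
    Prop :=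
  F.Faithful ∧ ∃ G : D ⥤ C, Nonempty (F ⊣ G) ∧ G.Faithful

namespace CStarCategory

/-- The endomorphisms of an object of a C*-category, as a C*-algebra. -/
def EndAlg {C : Type u} [CStarCategory.{v} C] (X : C) : Type v := X ⟶ X

instance {C : Type u} [CStarCategory.{v} C] (X : C) : NonUnitalCStarAlgebra (EndAlg X) where
  __ := (inferInstance : NormedAddCommGroup (X ⟶ X))
  __ := (inferInstance : NormedSpace ℂ (X ⟶ X))
  __ := (inferInstance : CompleteSpace (X ⟶ X))
  mul f g := (show X ⟶ X from g) ≫ (show X ⟶ X from f)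
  left_distrib f g h := add_comp' (C := C) _ _ _
  right_distrib f g h := comp_add' (C := C) _ _ _
  zero_mul f := Limits.comp_zero (C := C)
  mul_zero f := Limits.zero_comp (C := C)
  mul_assoc f g h := (Category.assoc (obj := C) _ _ _).symm
  norm_mul_le f g := (norm_comp_le (C := C) _ _).trans (mul_comm _ _).le
  star f := dag (C := C) f
  star_involutive f := dag_dag (C := C) f
  star_mul f g := dag_comp (C := C) _ _
  star_add f g := dag_add (C := C) _ _
  norm_mul_self_le f := (norm_comp_dag (C := C) (X := X) (Y := X) f).ge
  smul_assoc r f g := comp_smul' (C := C) _ _ _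
  smul_comm r f g := (smul_comp' (C := C) _ _ _).symm
  star_smul r f := dag_smul (C := C) _ _

end CStarCategory

theorem StarFunctor.norm_map_le {C : Type u₁} [CStarCategory.{v₁} C] {D : Type u₂}
    [CStarCategory.{v₂} D] (F : StarFunctor C D) {X Y : C} (f : X ⟶ Y) : ‖F.map f‖ ≤ ‖f‖ := by
  let φ : EndAlg X →⋆ₙₐ[ℂ] EndAlg (F.obj X) :=
    { toFun := fun f => F.map (X := X) (Y := X) f
      map_smul' := fun r f => F.map_smul' (X := X) (Y := X) r f
      map_zero' := by
        have := F.map_smul' (0 : ℂ) (0 : X ⟶ X)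
        rw [zero_smul, zero_smul] at this
        exact this
      map_add' := fun f g => F.map_add' (X := X) (Y := X) f g
      map_mul' := fun f g => F.map_comp (X := X) (Y := X) (Z := X) g f
      map_star' := fun f => F.map_dag (X := X) (Y := X) f }
  have h : ‖F.map (f ≫ dag f)‖ ≤ ‖f ≫ dag f‖ :=
    @NonUnitalStarAlgHom.norm_apply_le _ (EndAlg X) (EndAlg (F.obj X)) _ _ _ _ _ φ (f ≫ dag f)
  rw [F.map_comp, F.map_dag, norm_comp_dag, norm_comp_dag] at h
  exact abs_le_of_sq_le_sq' (by nlinarith) (norm_nonneg _) |>.2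

theorem StarFunctor.map_sum {C : Type u₁} [CStarCategory.{v₁} C] {D : Type u₂}
    [CStarCategory.{v₂} D] (F : StarFunctor C D) {X Y : C} {ι : Type*} (s : Finset ι)
    (f : ι → (X ⟶ Y)) : F.map (∑ i ∈ s, f i) = ∑ i ∈ s, F.map (f i) :=
  _root_.map_sum (AddMonoidHom.mk' (fun f : X ⟶ Y => F.map f) F.map_add') f s

/-- The adjacency matrix of a functor: `adj F w v = dim Hom(w, F v)`. -/
def adj {C : Type u₁} [SemisimpleCStarCategory.{v₁} C] {D : Type u₂}
    [SemisimpleCStarCategory.{v₂} D] (F : C ⥤ D) (w : V D) (v : V C) : ℕ :=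
  Module.finrank ℂ (simple w ⟶ F.obj (simple v))

theorem catTr_map {C : Type u₁} [SemisimpleCStarCategory.{v₁} C] {D : Type u₂}
    [SemisimpleCStarCategory.{v₂} D] (F : StarFunctor C D) (μ : V C → ℝ) (ν : V D → ℝ)
    (h : ∀ v, ∑ w, (adj F.toFunctor w v : ℝ) * ν w = μ v) (X : C) (α : X ⟶ X) :
    catTr ν (F.obj X) (F.map α) = catTr μ X α := by
  have h1 : ∀ v : V C, catTr ν (F.obj (simple v)) (𝟙 _) = (μ v : ℂ) := by
    intro v
    rw [← h v, catTr]
    push_cast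
    refine Finset.sum_congr rfl fun w _ => ?_
    have : ∀ a, scal (onb (F.obj (simple v)) w a ≫ 𝟙 _ ≫ dag (onb (F.obj (simple v)) w a)) = 1 := by
      intro a
      rw [Category.id_comp, onb_orth, if_pos rfl, scal_id]
    simp only [this, mul_one, Finset.sum_const, Finset.card_univ, Fintype.card_fin, nsmul_eq_mul,
      onbCard_eq_finrank, adj]
  have h2 : F.map α = ∑ v, ∑ a, F.map (dag (onb X v a)) ≫ F.map (onb X v a ≫ α) := by
    simp only [← F.map_comp, ← Category.assoc]
    simp only [← F.map_sum, ← Preadditive.sum_comp, onb_sum, Category.id_comp]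
  rw [h2, catTr_sum]
  refine Finset.sum_congr rfl fun v _ => ?_
  rw [catTr_sum]
  refine Finset.sum_congr rfl fun a _ => ?_
  rw [catTr_comm, ← F.map_comp, Category.assoc, scal_spec (onb X v a ≫ α ≫ dag (onb X v a)),
    F.map_smul', F.map_id, catTr_smul, h1, ← scal_spec, mul_comm]

/-! ### Increasing unions of pre-Hilbert spaces and their completions -/

/-- A sequence of (semi-)inner product spaces `E 0 → E 1 → ⋯` with isometric linear maps. -/
structure HilbertTower where
  E : ℕ → Type v
  acg : ∀ k, AddCommGroup (E k)
  mod : ∀ k, Module ℂ (E k)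
  core : ∀ k, PreInnerProductSpace.Core ℂ (E k)
  incl : ∀ k, E k →ₗ[ℂ] E (k + 1)
  incl_inner : ∀ k x y, (core (k + 1)).inner (incl k x) (incl k y) = (core k).inner x y

namespace HilbertTower

attribute [instance] HilbertTower.acg HilbertTower.mod

variable (S T : HilbertTower.{v})

/-- The composite `E i → E j` for `i ≤ j`. -/
def trans (i j : ℕ) (h : i ≤ j) : S.E i →ₗ[ℂ] S.E j :=
  Nat.leRec (motive := fun j _ => S.E i →ₗ[ℂ] S.E j) LinearMap.id
    (fun k _ g => (S.incl k).comp g) h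

theorem trans_self (i : ℕ) (x : S.E i) : S.trans i i le_rfl x = x := by
  rw [trans, Nat.leRec_self]; rfl

theorem trans_succ (i j : ℕ) (h : i ≤ j) (x : S.E i) :
    S.trans i (j + 1) (h.trans (Nat.le_succ j)) x = S.incl j (S.trans i j h x) := by
  rw [trans, Nat.leRec_succ _ _ h]; rfl

theorem trans_trans (i j k : ℕ) (h : i ≤ j) (h' : j ≤ k) (x : S.E i) :
    S.trans j k h' (S.trans i j h x) = S.trans i k (h.trans h') x := by
  induction h' with
  | refl => rw [trans_self]
  | step h' ih => rw [trans_succ _ _ _ h', trans_succ _ _ _ (h.trans h'), ih]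

theorem trans_inner (i j : ℕ) (h : i ≤ j) (x y : S.E i) :
    (S.core j).inner (S.trans i j h x) (S.trans i j h y) = (S.core i).inner x y := by
  induction h with
  | refl => rw [trans_self, trans_self]
  | step h ih => rw [trans_succ _ _ _ h, trans_succ _ _ _ h, incl_inner, ih]

instance : DirectedSystem S.E (fun i j h => S.trans i j h) where
  map_self i x := S.trans_self i x
  map_map i j k hij hjk x := S.trans_trans _ _ _ hij hjk x

/-- The union `⋃ E k` (direct limit of the `E k`). -/
def Alg : Type v := Module.DirectLimit S.E S.trans

instance : AddCommGroup S.Alg := Module.DirectLimit.addCommGroup S.E S.trans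
instance : Module ℂ S.Alg := Module.DirectLimit.module S.E S.trans

/-- The canonical map `E k → ⋃ E k`. -/
def of (k : ℕ) : S.E k →ₗ[ℂ] S.Alg := Module.DirectLimit.of ℂ ℕ S.E S.trans k

theorem of_trans (i j : ℕ) (h : i ≤ j) (x : S.E i) : S.of j (S.trans i j h x) = S.of i x :=
  Module.DirectLimit.of_f

theorem of_incl (k : ℕ) (x : S.E k) : S.of (k + 1) (S.incl k x) = S.of k x := by
  have := S.of_trans k (k + 1) (Nat.le_succ k) x
  rwa [trans_succ _ _ _ le_rfl, trans_self] at this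

theorem exists_of₂ (z w : S.Alg) : ∃ k x y, S.of k x = z ∧ S.of k y = w :=
  Module.DirectLimit.exists_of₂ z w

theorem inner_wd (i j : ℕ) (x y : S.E i) (x' y' : S.E j) (hx : S.of i x = S.of j x')
    (hy : S.of i y = S.of j y') : (S.core i).inner x y = (S.core j).inner x' y' := by
  have key : ∀ (x : S.E i) (x' : S.E j), S.of i x = S.of j x' →
      ∃ m, ∀ l (hi : i ≤ l) (hj : j ≤ l), m ≤ l → S.trans i l hi x = S.trans j l hj x' := by
    intro x x' h
    rw [← S.of_trans i (max i j) (le_max_left _ _), ← S.of_trans j (max i j) (le_max_right _ _)]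
      at h
    obtain ⟨m, hm, e⟩ := Module.DirectLimit.exists_eq_of_of_eq h
    refine ⟨m, fun l hi hj hl => ?_⟩
    have := congrArg (S.trans m l hl) e
    simpa only [trans_trans] using this
  obtain ⟨m₁, h₁⟩ := key x x' hx
  obtain ⟨m₂, h₂⟩ := key y y' hy
  have hi : i ≤ max (max i j) (max m₁ m₂) := by simp
  have hj : j ≤ max (max i j) (max m₁ m₂) := by simp
  rw [← S.trans_inner i _ hi, ← S.trans_inner j _ hj, h₁ _ hi hj (by simp), h₂ _ hi hj (by simp)]

/-- The scalar product of two elements of `⋃ E k`, computed in any `E k` containing both. -/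
def algInner (z w : S.Alg) : ℂ :=
  (S.core (S.exists_of₂ z w).choose).inner (S.exists_of₂ z w).choose_spec.choose
    (S.exists_of₂ z w).choose_spec.choose_spec.choose

theorem algInner_of (k : ℕ) (x y : S.E k) :
    S.algInner (S.of k x) (S.of k y) = (S.core k).inner x y :=
  S.inner_wd _ _ _ _ _ _
    (S.exists_of₂ (S.of k x) (S.of k y)).choose_spec.choose_spec.choose_spec.1
    (S.exists_of₂ (S.of k x) (S.of k y)).choose_spec.choose_spec.choose_spec.2

instance algCore : PreInnerProductSpace.Core ℂ S.Alg where
  inner := S.algInner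
  conj_inner_symm z w := by
    obtain ⟨k, x, y, rfl, rfl⟩ := S.exists_of₂ z w
    rw [algInner_of, algInner_of]; exact (S.core k).conj_inner_symm x y
  re_inner_nonneg z := by
    obtain ⟨k, x, -, rfl, -⟩ := S.exists_of₂ z z
    rw [algInner_of]; exact (S.core k).re_inner_nonneg x
  add_left z w u := by
    obtain ⟨k, x, y, rfl, rfl⟩ := S.exists_of₂ z w
    obtain ⟨l, x', y', rfl, hx⟩ := S.exists_of₂ u (S.of k x)
    have e₁ : S.of k x = S.of (max k l) (S.trans k _ (le_max_left _ _) x) := (S.of_trans ..).symm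
    have e₂ : S.of k y = S.of (max k l) (S.trans k _ (le_max_left _ _) y) := (S.of_trans ..).symm
    have e₃ : S.of l x' = S.of (max k l) (S.trans l _ (le_max_right _ _) x') :=
      (S.of_trans ..).symm
    rw [e₁, e₂, e₃, ← map_add, algInner_of, algInner_of, algInner_of]
    exact (S.core _).add_left _ _ _
  smul_left z w r := by
    obtain ⟨k, x, y, rfl, rfl⟩ := S.exists_of₂ z w
    rw [← map_smul, algInner_of, algInner_of]; exact (S.core k).smul_left x y r

instance : SeminormedAddCommGroup S.Alg :=
  InnerProductSpace.Core.toSeminormedAddCommGroup (𝕜 := ℂ) (F := S.Alg)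

instance : InnerProductSpace ℂ S.Alg := InnerProductSpace.ofCore S.algCore

theorem inner_of (k : ℕ) (x y : S.E k) :
    inner ℂ (S.of k x) (S.of k y) = (S.core k).inner x y := S.algInner_of k x y

/-- The Hilbert space completion of `⋃ E k`. -/
abbrev H : Type v := UniformSpace.Completion S.Alg

/-- The canonical map `E k → H`. -/
def ι (k : ℕ) : S.E k →ₗ[ℂ] S.H :=
  (UniformSpace.Completion.toComplL (𝕜 := ℂ) (E := S.Alg)).toLinearMap.comp (S.of k)

/-- A compatible family of operators defined from level `k` on, bounded by a common constant,
extends to the Hilbert space completions. -/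
theorem exists_op (k : ℕ) (f : ∀ l, S.E (k + l) →ₗ[ℂ] T.E (k + l))
    (comm : ∀ l x, f (l + 1) (S.incl (k + l) x) = T.incl (k + l) (f l x)) (c : ℝ)
    (bd : ∀ l x, ((T.core (k + l)).inner (f l x) (f l x)).re ≤
      c ^ 2 * ((S.core (k + l)).inner x x).re) :
    ∃ t : S.H →L[ℂ] T.H, ∀ l x, t (S.ι (k + l) x) = T.ι (k + l) (f l x) := by
  have ftrans : ∀ l l' (h : k + l ≤ k + l') x,
      f l' (S.trans (k + l) (k + l') h x) = T.trans (k + l) (k + l') h (f l x) := by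
    intro l l' h x
    obtain ⟨d, rfl⟩ := Nat.exists_eq_add_of_le (Nat.le_of_add_le_add_left h)
    induction d with
    | zero =>
      have e₁ : S.trans (k + l) (k + (l + 0)) h x = x := S.trans_self _ x
      have e₂ : T.trans (k + l) (k + (l + 0)) h (f l x) = f l x := T.trans_self _ _
      rw [e₁, e₂]
      rfl
    | succ d ih =>
      have h' : k + l ≤ k + (l + d) := by omega
      have e₁ : S.trans (k + l) (k + (l + (d + 1))) h x =
        S.incl (k + (l + d)) (S.trans (k + l) (k + (l + d)) h' x) := S.trans_succ _ _ h' x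
      have e₂ : T.trans (k + l) (k + (l + (d + 1))) h (f l x) =
        T.incl (k + (l + d)) (T.trans (k + l) (k + (l + d)) h' (f l x)) := T.trans_succ _ _ h' _
      rw [e₁, e₂, ← ih h']
      exact comm (l + d) _
  let g : S.Alg →ₗ[ℂ] T.Alg := Module.DirectLimit.lift ℂ ℕ S.E S.trans
    (fun i => ((T.of (k + i)).comp (f i)).comp (S.trans i (k + i) (Nat.le_add_left i k)))
    (by
      intro i j hij x
      simp only [LinearMap.comp_apply]
      rw [trans_trans, ← S.trans_trans i (k + i) (k + j) (Nat.le_add_left i k) (by omega),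
        ftrans, of_trans])
  have hg : ∀ l x, g (S.of (k + l) x) = T.of (k + l) (f l x) := by
    intro l x
    have : g (S.of (k + l) x) = T.of (k + (k + l)) (f (k + l)
        (S.trans (k + l) (k + (k + l)) (Nat.le_add_left _ _) x)) :=
      Module.DirectLimit.lift_of _ _ _
    rw [this, ftrans, of_trans]
  have hb : ∀ z, ‖g z‖ ≤ |c| * ‖z‖ := by
    intro z
    obtain ⟨i, x, -, rfl, -⟩ := S.exists_of₂ z z
    rw [← S.of_trans i (k + i) (Nat.le_add_left i k), hg]
    refine abs_le_of_sq_le_sq' ?_ (by positivity) |>.2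
    rw [mul_pow, sq_abs, @norm_sq_eq_re_inner ℂ, @norm_sq_eq_re_inner ℂ, inner_of, inner_of]
    exact bd i _
  let e : S.Alg →ₗ[ℂ] S.H := (UniformSpace.Completion.toComplL (𝕜 := ℂ) (E := S.Alg)).toLinearMap
  let e' : T.Alg →ₗ[ℂ] T.H := (UniformSpace.Completion.toComplL (𝕜 := ℂ) (E := T.Alg)).toLinearMap
  refine ⟨(e'.comp g).extendOfNorm e, fun l x => ?_⟩
  have := LinearMap.extendOfNorm_eq (f := e'.comp g) (e := e)
    UniformSpace.Completion.denseRange_coe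
    ⟨|c|, fun z => by
      have h1 : ‖e' (g z)‖ = ‖g z‖ := UniformSpace.Completion.norm_coe _
      have h2 : ‖e z‖ = ‖z‖ := UniformSpace.Completion.norm_coe _
      rw [LinearMap.comp_apply, h1, h2]
      exact hb z⟩ (S.of (k + l) x)
  refine this.trans ?_
  rw [LinearMap.comp_apply, hg]
  rfl

end HilbertTower

/-! ### 0-cells, 1-cells and loop operators -/

/-- A 0-cell: a Bratteli diagram `Γ_{k+1} : M_k → M_{k+1}` of finite semisimple C*-categories and
bi-faithful `*`-linear functors, together with positive weights satisfying `∑_v μ^0_v = 1` and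
`(Γ_{k+1})' μ^{k+1} = μ^k`. The functor `Γ k` is the one from level `k` to level `k + 1`. -/
structure ZeroCell where
  M : ℕ → Type u
  cat : ∀ k, SemisimpleCStarCategory.{v} (M k)
  Γ : ∀ k, StarFunctor (M k) (M (k + 1))
  biFaithful : ∀ k, BiFaithful (Γ k).toFunctor
  μ : ∀ k, V (M k) → ℝ
  μ_pos : ∀ k v, 0 < μ k v
  μ_sum : ∑ v, μ 0 v = 1
  μ_compat : ∀ k v, ∑ w, (adj (Γ k).toFunctor w v : ℝ) * μ (k + 1) w = μ k v

attribute [instance] ZeroCell.cat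

namespace ZeroCell

variable (Γ : ZeroCell.{v, u})

/-- The object `m_0 = ⨁_{v ∈ V_0} v`. -/
def m₀ : Γ.M 0 := (exists_sum (V (Γ.M 0)) (fun v => (simple v : Γ.M 0))).choose

/-- The object `Γ_k ⋯ Γ_1 m_0`. -/
def obj : ∀ k, Γ.M k
  | 0 => Γ.m₀
  | k + 1 => (Γ.Γ k).obj (obj k)

/-- The image `Γ_{k+l} ⋯ Γ_{k+1} α` of `α ∈ A_k = End(Γ_k ⋯ Γ_1 m_0)` in `A_{k+l}`. -/
def lift {k : ℕ} (α : Γ.obj k ⟶ Γ.obj k) : ∀ l, Γ.obj (k + l) ⟶ Γ.obj (k + l)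
  | 0 => α
  | l + 1 => (Γ.Γ (k + l)).map (lift α l)

theorem norm_lift_le {k : ℕ} (α : Γ.obj k ⟶ Γ.obj k) (l : ℕ) : ‖Γ.lift α l‖ ≤ ‖α‖ := by
  induction l with
  | zero => exact le_rfl
  | succ l ih => exact ((Γ.Γ (k + l)).norm_map_le _).trans ih

end ZeroCell

/-- A 1-cell: `*`-linear bi-faithful functors `Λ_k : M_k → N_k` with natural unitaries
`W_{k+1} : Δ_{k+1} Λ_k → Λ_{k+1} Γ_{k+1}` (here `W k`), subject to
`ε μ^k_v ≤ [Λ_k' ν^k]_v ≤ C μ^k_v`. -/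
structure OneCell (Γ : ZeroCell.{v₁, u₁}) (Δ : ZeroCell.{v₂, u₂}) where
  F : ∀ k, StarFunctor (Γ.M k) (Δ.M k)
  biFaithful : ∀ k, BiFaithful (F k).toFunctor
  W : ∀ k, (F k).toFunctor ⋙ (Δ.Γ k).toFunctor ⟶ (Γ.Γ k).toFunctor ⋙ (F (k + 1)).toFunctor
  W_dag : ∀ k X, (W k).app X ≫ dag ((W k).app X) = 𝟙 _
  dag_W : ∀ k X, dag ((W k).app X) ≫ (W k).app X = 𝟙 _
  bounded : ∃ ε C : ℝ, 0 < ε ∧ 0 < C ∧ ∀ k v,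
    ε * Γ.μ k v ≤ ∑ w, (adj (F k).toFunctor w v : ℝ) * Δ.μ k w ∧
    ∑ w, (adj (F k).toFunctor w v : ℝ) * Δ.μ k w ≤ C * Γ.μ k v

/-- A tracial solution of the conjugate equations for the duality of `F : C → D`, commensurate
with the weights `μ` on `C` and `ν` on `D`: an adjoint `*`-linear functor `bar : D → C` with
`rho : 1_D → F bar` and `rho' : 1_C → bar F` such that
`(rho'_v)† ∘ bar(σ τ†) ∘ rho'_v = (ν_w / μ_v) ⟨σ, τ⟩ 1_v` for all `σ, τ : w → F v`. -/
structure TracialSolution {C : Type u₁} [SemisimpleCStarCategory.{v₁} C] {D : Type u₂}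
    [SemisimpleCStarCategory.{v₂} D] (F : StarFunctor C D) (μ : V C → ℝ) (ν : V D → ℝ) where
  bar : StarFunctor D C
  rho : 𝟭 D ⟶ bar.toFunctor ⋙ F.toFunctor
  rho' : 𝟭 C ⟶ F.toFunctor ⋙ bar.toFunctor
  conj : ∀ X : C, (rho.app (F.obj X) : F.obj X ⟶ F.obj (bar.obj (F.obj X))) ≫
    dag (F.map (rho'.app X : X ⟶ bar.obj (F.obj X))) = 𝟙 (F.obj X)
  conj' : ∀ Y : D, (rho'.app (bar.obj Y) : bar.obj Y ⟶ bar.obj (F.obj (bar.obj Y))) ≫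
    dag (bar.map (rho.app Y : Y ⟶ F.obj (bar.obj Y))) = 𝟙 (bar.obj Y)
  tracial : ∀ (v : V C) (w : V D) (σ τ : simple w ⟶ F.obj (simple v)),
    (rho'.app (simple v) : simple v ⟶ bar.obj (F.obj (simple v))) ≫ bar.map (dag τ ≫ σ) ≫
      dag (rho'.app (simple v) : simple v ⟶ bar.obj (F.obj (simple v))) =
    (((ν w / μ v : ℝ) : ℂ) * scal (σ ≫ dag τ)) • 𝟙 (simple v)

theorem CStarCategory.dag_naturality {C : Type u₁} [CStarCategory.{v₁} C] {D : Type u₂}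
    [CStarCategory.{v₂} D] {F G : C ⥤ D}
    (hF : ∀ {X Y : C} (f : X ⟶ Y), F.map (dag f) = dag (F.map f))
    (hG : ∀ {X Y : C} (f : X ⟶ Y), G.map (dag f) = dag (G.map f)) (η : F ⟶ G) {X Y : C}
    (f : X ⟶ Y) : G.map f ≫ dag (η.app Y) = dag (η.app X) ≫ F.map f := by
  have h := congrArg dag (η.naturality (dag f))
  rw [dag_comp, dag_comp, hF, hG, dag_dag, dag_dag] at h
  exact h.symm

section Cells

variable {Γ : ZeroCell.{v₁, u₁}} {Δ : ZeroCell.{v₂, u₂}}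

/-- A choice, for every `k`, of a tracial solution for `Δ_{k+1}` commensurate with
`(ν^k, ν^{k+1})`. -/
abbrev Solutions (Δ : ZeroCell.{v, u}) :=
  ∀ k, TracialSolution (Δ.Γ k) (Δ.μ k) (Δ.μ (k + 1))

/-- Natural transformations from `Λ_k` to `Ω_k`. -/
abbrev NT (Λ Ω : OneCell Γ Δ) (k : ℕ) := (Λ.F k).toFunctor ⟶ (Ω.F k).toFunctor

/-- The loop operator `S_{k+1} : NT(Λ_{k+1}, Ω_{k+1}) → NT(Λ_k, Ω_k)`:
`(S η)_X = ρ'† ∘ Δ'(W^Ω† ∘ η_{Γ X} ∘ W^Λ) ∘ ρ'`. -/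
def loop (R : Solutions Δ) (Λ Ω : OneCell Γ Δ) (k : ℕ) (η : NT Λ Ω (k + 1)) : NT Λ Ω k where
  app X := ((R k).rho'.app ((Λ.F k).obj X) :
      (Λ.F k).obj X ⟶ (R k).bar.obj ((Δ.Γ k).obj ((Λ.F k).obj X))) ≫
    (R k).bar.map ((Λ.W k).app X ≫ η.app ((Γ.Γ k).obj X) ≫ dag ((Ω.W k).app X)) ≫
    dag ((R k).rho'.app ((Ω.F k).obj X) :
      (Ω.F k).obj X ⟶ (R k).bar.obj ((Δ.Γ k).obj ((Ω.F k).obj X)))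
  naturality X Y f := by
    have h₁ := (R k).rho'.naturality ((Λ.F k).map f)
    have h₂ : (Δ.Γ k).map ((Λ.F k).map f) ≫ (Λ.W k).app Y ≫ η.app ((Γ.Γ k).obj Y) ≫
        dag ((Ω.W k).app Y) = ((Λ.W k).app X ≫ η.app ((Γ.Γ k).obj X) ≫ dag ((Ω.W k).app X)) ≫
        (Δ.Γ k).map ((Ω.F k).map f) := by
      have e₁ := (Λ.W k).naturality f
      have e₂ := η.naturality ((Γ.Γ k).map f)
      have e₃ := dag_naturality (F := (Ω.F k).toFunctor ⋙ (Δ.Γ k).toFunctor)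
        (G := (Γ.Γ k).toFunctor ⋙ (Ω.F (k + 1)).toFunctor)
        (fun g => by simp only [Functor.comp_map, StarFunctor.map_dag])
        (fun g => by simp only [Functor.comp_map, StarFunctor.map_dag]) (Ω.W k) f
      simp only [Functor.comp_map] at e₁ e₃
      rw [← Category.assoc, e₁, Category.assoc, ← Category.assoc ((Λ.F (k + 1)).map _), e₂,
        Category.assoc, e₃]
      simp only [Category.assoc]
    have h₃ := dag_naturality (F := 𝟭 (Δ.M k)) (G := (Δ.Γ k).toFunctor ⋙ (R k).bar.toFunctor)
        (fun g => rfl) (fun g => by simp only [Functor.comp_map, StarFunctor.map_dag])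
        (R k).rho' ((Ω.F k).map f)
    have h₄ := (((R k).bar.map_comp _ _).symm.trans (congrArg (R k).bar.map h₂)).trans
      ((R k).bar.map_comp _ _)
    simp only [Functor.comp_map, Functor.id_map] at h₁ h₃
    refine (Category.assoc _ _ _).symm.trans ((congrArg (· ≫ _) h₁).trans ?_)
    refine (Category.assoc _ _ _).trans ?_
    refine Eq.trans (congrArg (_ ≫ ·) (Category.assoc _ _ _).symm) ?_
    refine Eq.trans (congrArg (fun t => _ ≫ t ≫ _) h₄) ?_
    refine Eq.trans (congrArg (_ ≫ ·) ((Category.assoc _ _ _).trans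
      (congrArg (_ ≫ ·) h₃))) ?_
    exact ((Category.assoc _ _ _).trans (congrArg (_ ≫ ·) (Category.assoc _ _ _))).symm

/-- `S_{k+1} ⋯ S_{k+l} : NT(Λ_{k+l}, Ω_{k+l}) → NT(Λ_k, Ω_k)`. -/
def loopIter (R : Solutions Δ) (Λ Ω : OneCell Γ Δ) (k : ℕ) : ∀ l, NT Λ Ω (k + l) → NT Λ Ω k
  | 0, η => η
  | l + 1, η => loopIter R Λ Ω k l (loop R Λ Ω (k + l) η)

/-- A bounded quasi-flat sequence (BQFS) from `Λ` to `Ω`; boundedness is in the C*-norm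
`‖η‖ = sup_X ‖η_X‖` of natural transformations. -/
structure BQFS (R : Solutions Δ) (Λ Ω : OneCell Γ Δ) where
  seq : ∀ k, NT Λ Ω k
  quasiFlat : ∀ k, loop R Λ Ω k (seq (k + 1)) = seq k
  bounded : ∃ c : ℝ, ∀ k X, ‖(seq k).app X‖ ≤ c

/-- Convergence in `NT(Λ_k, Ω_k)` with respect to the C*-norm `‖η‖ = sup_X ‖η_X‖`. -/
def NTTendsto {Λ Ω : OneCell Γ Δ} {k : ℕ} (θ : ℕ → NT Λ Ω k) (ψ : NT Λ Ω k) : Prop :=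
  ∀ ε : ℝ, 0 < ε → ∃ N, ∀ l, N ≤ l → ∀ X, ‖(θ l).app X - ψ.app X‖ ≤ ε

end Cells

/-! ### The von Neumann algebra of a 0-cell and the bimodule of a 1-cell -/

/-- The tower `A_0 ⊆ A_1 ⊆ ⋯`, `A_k = End(Γ_k ⋯ Γ_1 m_0)`, with scalar products
`⟨x, y⟩ = Tr(x† ∘ y)`. -/
def ZeroCell.tower (Γ : ZeroCell.{v, u}) : HilbertTower.{v} where
  E k := Γ.obj k ⟶ Γ.obj k
  acg k := inferInstance
  mod k := inferInstance
  core k := homCore (Γ.μ k) (Γ.μ_pos k) _ _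
  incl k :=
    { toFun := fun x => (Γ.Γ k).map x
      map_add' := (Γ.Γ k).map_add'
      map_smul' := (Γ.Γ k).map_smul' }
  incl_inner k x y := by
    change catTr _ _ ((Γ.Γ k).map y ≫ dag ((Γ.Γ k).map x)) = catTr _ _ (y ≫ dag x)
    rw [← StarFunctor.map_dag, ← Functor.map_comp]
    exact catTr_map (Γ.Γ k) (Γ.μ k) (Γ.μ (k + 1)) (Γ.μ_compat k) _ _

/-- The GNS Hilbert space `L²(A_∞, Tr)`. -/
abbrev ZeroCell.L2 (Γ : ZeroCell.{v, u}) : Type v := Γ.tower.H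

theorem ZeroCell.exists_leftMul (Γ : ZeroCell.{v, u}) (k : ℕ) (α : Γ.obj k ⟶ Γ.obj k) :
    ∃ t : Γ.L2 →L[ℂ] Γ.L2, ∀ (l : ℕ) (x : Γ.obj (k + l) ⟶ Γ.obj (k + l)),
      t (Γ.tower.ι (k + l) x) = Γ.tower.ι (k + l) (x ≫ Γ.lift α l) := by
  refine Γ.tower.exists_op Γ.tower k
    (fun l =>
      { toFun := fun x => (show Γ.obj (k + l) ⟶ Γ.obj (k + l) from x) ≫ Γ.lift α l
        map_add' := fun x y => add_comp' (C := Γ.M (k + l)) _ _ _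
        map_smul' := fun r x => smul_comp' (C := Γ.M (k + l)) _ _ _ })
    (fun l x => ((Γ.Γ (k + l)).map_comp _ _).symm) ‖α‖ (fun l x => ?_)
  refine (catTr_comp_le (Γ.μ (k + l)) (Γ.μ_pos (k + l)) (C := Γ.M (k + l)) x (Γ.lift α l)).trans ?_
  refine mul_le_mul_of_nonneg_right ?_ ((Γ.tower.core (k + l)).re_inner_nonneg x)
  have := Γ.norm_lift_le α l
  gcongr

/-- Left multiplication by `α ∈ A_k` on `L²(A_∞, Tr)`. -/
def ZeroCell.leftMul (Γ : ZeroCell.{v, u}) (k : ℕ) (α : Γ.obj k ⟶ Γ.obj k) : Γ.L2 →L[ℂ] Γ.L2 :=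
  (Γ.exists_leftMul k α).choose

/-- The von Neumann algebra of a 0-cell: the double commutant of `A_∞` acting on
`L²(A_∞, Tr)`. -/
def ZeroCell.PB (Γ : ZeroCell.{v, u}) : VonNeumannAlgebra Γ.L2 where
  toStarSubalgebra := StarSubalgebra.centralizer ℂ
    (StarSubalgebra.centralizer ℂ {t | ∃ k α, t = Γ.leftMul k α} : Set (Γ.L2 →L[ℂ] Γ.L2))
  centralizer_centralizer' := Set.centralizer_centralizer_centralizer _

namespace OneCell

variable {Γ : ZeroCell.{v₁, u₁}} {Δ : ZeroCell.{v₂, u₂}} (Λ Ω Ξ : OneCell Γ Δ)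

/-- The tower `H_0 → H_1 → ⋯`, `H_k = N_k(Δ_k ⋯ Δ_1 n_0, Λ_k Γ_k ⋯ Γ_1 m_0)`, with inclusions
`ξ ↦ W_{k+1} ∘ Δ_{k+1} ξ` and scalar products `⟨x, y⟩ = Tr(x† ∘ y)`. -/
def tower : HilbertTower.{v₂} where
  E k := Δ.obj k ⟶ (Λ.F k).obj (Γ.obj k)
  acg k := inferInstance
  mod k := inferInstance
  core k := homCore (Δ.μ k) (Δ.μ_pos k) _ _
  incl k :=
    { toFun := fun x => (Δ.Γ k).map x ≫ (Λ.W k).app (Γ.obj k)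
      map_add' := fun x y => by rw [(Δ.Γ k).map_add']; exact add_comp' (C := Δ.M (k + 1)) _ _ _
      map_smul' := fun r x => by
        rw [(Δ.Γ k).map_smul']; exact smul_comp' (C := Δ.M (k + 1)) _ _ _ }
  incl_inner k x y := by
    change catTr _ _ (((Δ.Γ k).map y ≫ (Λ.W k).app (Γ.obj k)) ≫
      dag ((Δ.Γ k).map x ≫ (Λ.W k).app (Γ.obj k))) = catTr _ _ (y ≫ dag x)
    have e : ((Δ.Γ k).map y ≫ (Λ.W k).app (Γ.obj k)) ≫
        dag ((Δ.Γ k).map x ≫ (Λ.W k).app (Γ.obj k)) = (Δ.Γ k).map (y ≫ dag x) := by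
      rw [dag_comp, Category.assoc, ← Category.assoc ((Λ.W k).app _), Λ.W_dag, Functor.map_comp,
        StarFunctor.map_dag]
      exact congrArg (_ ≫ ·) (Category.id_comp _)
    rw [e]
    exact catTr_map (Δ.Γ k) (Δ.μ k) (Δ.μ (k + 1)) (Δ.μ_compat k) _ _

/-- The Hilbert space `H` underlying the bimodule of the 1-cell `Λ`: the completion of
`H_∞ = ⋃ H_k`. -/
abbrev H : Type v₂ := Λ.tower.H

/-- The canonical map `H_k → H`. -/
def ι (k : ℕ) (ξ : Δ.obj k ⟶ (Λ.F k).obj (Γ.obj k)) : Λ.H := Λ.tower.ι k ξ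

theorem exists_left (k : ℕ) (α : Γ.obj k ⟶ Γ.obj k) :
    ∃ t : Λ.H →L[ℂ] Λ.H, ∀ l ξ,
      t (Λ.ι (k + l) ξ) = Λ.ι (k + l) (ξ ≫ (Λ.F (k + l)).map (Γ.lift α l)) := by
  refine Λ.tower.exists_op Λ.tower k
    (fun l =>
      { toFun := fun x => (show Δ.obj (k + l) ⟶ (Λ.F (k + l)).obj (Γ.obj (k + l)) from x) ≫
          (Λ.F (k + l)).map (Γ.lift α l)
        map_add' := fun x y => add_comp' (C := Δ.M (k + l)) _ _ _
        map_smul' := fun r x => smul_comp' (C := Δ.M (k + l)) _ _ _ })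
    (fun l (x : Δ.obj (k + l) ⟶ (Λ.F (k + l)).obj (Γ.obj (k + l))) => ?_) ‖α‖ (fun l x => ?_)
  · have h := (Λ.W (k + l)).naturality (Γ.lift α l)
    change ((Δ.Γ (k + l)).map x ≫ (Λ.W (k + l)).app _) ≫
        (Λ.F (k + l + 1)).map ((Γ.Γ (k + l)).map (Γ.lift α l)) =
      (Δ.Γ (k + l)).map (x ≫ (Λ.F (k + l)).map (Γ.lift α l)) ≫ (Λ.W (k + l)).app _
    rw [Functor.map_comp]
    exact (Category.assoc _ _ _).trans ((congrArg (_ ≫ ·) h.symm).trans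
      (Category.assoc _ _ _).symm)
  · refine (catTr_comp_le (Δ.μ (k + l)) (Δ.μ_pos (k + l)) (C := Δ.M (k + l)) x
      ((Λ.F (k + l)).map (Γ.lift α l))).trans ?_
    refine mul_le_mul_of_nonneg_right ?_ ((Λ.tower.core (k + l)).re_inner_nonneg x)
    have := ((Λ.F (k + l)).norm_map_le _).trans (Γ.norm_lift_le α l)
    gcongr

/-- The left action `ξ ↦ Λ_k(α) ∘ ξ` of `α ∈ A_k` on `H`. -/
def left (k : ℕ) (α : Γ.obj k ⟶ Γ.obj k) : Λ.H →L[ℂ] Λ.H := (Λ.exists_left k α).choose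

theorem exists_right (k : ℕ) (β : Δ.obj k ⟶ Δ.obj k) :
    ∃ t : Λ.H →L[ℂ] Λ.H, ∀ l ξ, t (Λ.ι (k + l) ξ) = Λ.ι (k + l) (Δ.lift β l ≫ ξ) := by
  refine Λ.tower.exists_op Λ.tower k
    (fun l =>
      { toFun := fun x => Δ.lift β l ≫
          (show Δ.obj (k + l) ⟶ (Λ.F (k + l)).obj (Γ.obj (k + l)) from x)
        map_add' := fun x y => comp_add' (C := Δ.M (k + l)) _ _ _
        map_smul' := fun r x => comp_smul' (C := Δ.M (k + l)) _ _ _ })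
    (fun l (x : Δ.obj (k + l) ⟶ (Λ.F (k + l)).obj (Γ.obj (k + l))) => ?_) ‖β‖ (fun l x => ?_)
  · change (Δ.Γ (k + l)).map (Δ.lift β l) ≫ ((Δ.Γ (k + l)).map x ≫ (Λ.W (k + l)).app _) =
      (Δ.Γ (k + l)).map (Δ.lift β l ≫ x) ≫ (Λ.W (k + l)).app _
    rw [Functor.map_comp]
    exact (Category.assoc _ _ _).symm
  · have h := catTr_comp_le' (Δ.μ (k + l)) (Δ.μ_pos (k + l)) (C := Δ.M (k + l)) (Δ.lift β l)
      (show Δ.obj (k + l) ⟶ (Λ.F (k + l)).obj (Γ.obj (k + l)) from x)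
    refine h.trans ?_
    refine mul_le_mul_of_nonneg_right ?_ ((Λ.tower.core (k + l)).re_inner_nonneg x)
    have := Δ.norm_lift_le β l
    gcongr

/-- The right action `ξ ↦ ξ ∘ β` of `β ∈ B_k` on `H`. -/
def right (k : ℕ) (β : Δ.obj k ⟶ Δ.obj k) : Λ.H →L[ℂ] Λ.H := (Λ.exists_right k β).choose

variable {Λ Ω}

/-- The image in `N_{k+l}(Λ_{k+l} ⋯ m_0, Ω_{k+l} ⋯ m_0)` of
`γ ∈ N_k(Λ_k Γ_k ⋯ Γ_1 m_0, Ω_k Γ_k ⋯ Γ_1 m_0)`, obtained by iterating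
`γ ↦ W^Ω ∘ Δ γ ∘ (W^Λ)†`. -/
def push {k : ℕ} (γ : (Λ.F k).obj (Γ.obj k) ⟶ (Ω.F k).obj (Γ.obj k)) :
    ∀ l, (Λ.F (k + l)).obj (Γ.obj (k + l)) ⟶ (Ω.F (k + l)).obj (Γ.obj (k + l))
  | 0 => γ
  | l + 1 => dag ((Λ.W (k + l)).app (Γ.obj (k + l))) ≫ (Δ.Γ (k + l)).map (push γ l) ≫
      (Ω.W (k + l)).app (Γ.obj (k + l))

theorem norm_push_le {k : ℕ} (γ : (Λ.F k).obj (Γ.obj k) ⟶ (Ω.F k).obj (Γ.obj k)) (l : ℕ) :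
    ‖push γ l‖ ≤ ‖γ‖ := by
  induction l with
  | zero => exact le_rfl
  | succ l ih =>
    have h₁ : ‖dag ((Λ.W (k + l)).app (Γ.obj (k + l)))‖ ≤ 1 :=
      norm_le_one_of_isometry _ (by rw [dag_dag]; exact Λ.dag_W _ _)
    have h₂ : ‖(Ω.W (k + l)).app (Γ.obj (k + l))‖ ≤ 1 := norm_le_one_of_isometry _ (Ω.W_dag _ _)
    have h₃ := ((Δ.Γ (k + l)).norm_map_le (push γ l)).trans ih
    refine (norm_comp_le _ _).trans ?_
    refine (mul_le_mul h₁ (norm_comp_le _ _) (norm_nonneg _) zero_le_one).trans ?_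
    rw [one_mul]
    refine (mul_le_mul h₃ h₂ (norm_nonneg _) (norm_nonneg _)).trans ?_
    rw [mul_one]

theorem exists_phi (k : ℕ) (γ : (Λ.F k).obj (Γ.obj k) ⟶ (Ω.F k).obj (Γ.obj k)) :
    ∃ t : Λ.H →L[ℂ] Ω.H, ∀ l ξ, t (Λ.ι (k + l) ξ) = Ω.ι (k + l) (ξ ≫ push γ l) := by
  refine Λ.tower.exists_op Ω.tower k
    (fun l =>
      { toFun := fun x => (show Δ.obj (k + l) ⟶ (Λ.F (k + l)).obj (Γ.obj (k + l)) from x) ≫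
          push γ l
        map_add' := fun x y => add_comp' (C := Δ.M (k + l)) _ _ _
        map_smul' := fun r x => smul_comp' (C := Δ.M (k + l)) _ _ _ })
    (fun l (x : Δ.obj (k + l) ⟶ (Λ.F (k + l)).obj (Γ.obj (k + l))) => ?_) ‖γ‖ (fun l x => ?_)
  · change ((Δ.Γ (k + l)).map x ≫ (Λ.W (k + l)).app _) ≫
        dag ((Λ.W (k + l)).app (Γ.obj (k + l))) ≫ (Δ.Γ (k + l)).map (push γ l) ≫
        (Ω.W (k + l)).app (Γ.obj (k + l)) =
      (Δ.Γ (k + l)).map (x ≫ push γ l) ≫ (Ω.W (k + l)).app _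
    rw [Functor.map_comp, Category.assoc, ← Category.assoc ((Λ.W (k + l)).app _), Λ.W_dag]
    exact (congrArg (_ ≫ ·) (Category.id_comp _)).trans (Category.assoc _ _ _).symm
  · refine (catTr_comp_le (Δ.μ (k + l)) (Δ.μ_pos (k + l)) (C := Δ.M (k + l)) x
      (push γ l)).trans ?_
    refine mul_le_mul_of_nonneg_right ?_ ((Λ.tower.core (k + l)).re_inner_nonneg x)
    have := norm_push_le γ l
    gcongr

/-- The bounded operator `Φ_γ : H → G`, determined by `ξ ↦ γ ∘ ξ` on `H_{k+l}`. -/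
def phi (k : ℕ) (γ : (Λ.F k).obj (Γ.obj k) ⟶ (Ω.F k).obj (Γ.obj k)) : Λ.H →L[ℂ] Ω.H :=
  (exists_phi k γ).choose

end OneCell

/-- A linear map `π` from a von Neumann algebra on `K` to the bounded operators on `H` is normal if
it is continuous for the ultraweak topologies: every `a ↦ ⟨ζ, π(a) ξ⟩` has the form
`∑ ⟨y_n, a x_n⟩` with square-summable `x, y`. -/
def IsNormalMap {K : Type v₁} [NormedAddCommGroup K] [InnerProductSpace ℂ K] [CompleteSpace K]
    {H : Type v₂} [NormedAddCommGroup H] [InnerProductSpace ℂ H] (A : VonNeumannAlgebra K)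
    (π : A.toStarSubalgebra → (H →L[ℂ] H)) : Prop :=
  ∀ ξ ζ : H, ∃ x y : ℕ → K, Summable (fun n => ‖x n‖ ^ 2) ∧ Summable (fun n => ‖y n‖ ^ 2) ∧
    ∀ a : A.toStarSubalgebra,
      HasSum (fun n => inner ℂ (y n) ((a : K →L[ℂ] K) (x n))) (inner ℂ ζ (π a ξ))

namespace OneCell

variable {Γ : ZeroCell.{v₁, u₁}} {Δ : ZeroCell.{v₂, u₂}} (Λ Ω Ξ : OneCell Γ Δ)

/-- `π` is the left action of the von Neumann algebra `A` on `H`: the normal extension of the left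
action of `A_∞`. -/
def IsLeftAction (π : Γ.PB.toStarSubalgebra →⋆ₐ[ℂ] (Λ.H →L[ℂ] Λ.H)) : Prop :=
  IsNormalMap Γ.PB π ∧ ∀ (k : ℕ) (α : Γ.obj k ⟶ Γ.obj k)
    (a : Γ.PB.toStarSubalgebra), (a : Γ.L2 →L[ℂ] Γ.L2) = Γ.leftMul k α → π a = Λ.left k α

/-- `π` is the right action of the von Neumann algebra `B` on `H`: the normal extension of the
right action of `B_∞`. -/
def IsRightAction (π : (Δ.PB.toStarSubalgebra)ᵐᵒᵖ →⋆ₐ[ℂ] (Λ.H →L[ℂ] Λ.H)) : Prop :=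
  IsNormalMap Δ.PB (fun b => π (MulOpposite.op b)) ∧ ∀ (k : ℕ) (β : Δ.obj k ⟶ Δ.obj k)
    (b : Δ.PB.toStarSubalgebra), (b : Δ.L2 →L[ℂ] Δ.L2) = Δ.leftMul k β →
      π (MulOpposite.op b) = Λ.right k β

variable {Λ Ω}

/-- `T` is an `A_∞`-`B_∞`-bimodule map, and an `A`-`B`-bimodule map for the normal extensions of
the actions to the von Neumann algebras `A` and `B`. -/
structure IsBimoduleMap (T : Λ.H →L[ℂ] Ω.H) : Prop where
  left : ∀ k α, T ∘L Λ.left k α = Ω.left k α ∘L T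
  right : ∀ k β, T ∘L Λ.right k β = Ω.right k β ∘L T
  left' : ∀ π π', Λ.IsLeftAction π → Ω.IsLeftAction π' → ∀ a, T ∘L π a = π' a ∘L T
  right' : ∀ π π', Λ.IsRightAction π → Ω.IsRightAction π' → ∀ b, T ∘L π b = π' b ∘L T

end OneCell

section TwoCells

variable {Γ : ZeroCell.{v₁, u₁}} {Δ : ZeroCell.{v₂, u₂}} {R : Solutions Δ} {Λ Ω : OneCell Γ Δ}

/-- `T` is the limit of `Φ_{η^(k)}` in the strong operator topology. -/
def BQFS.IsLimit (η : BQFS R Λ Ω) (T : Λ.H →L[ℂ] Ω.H) : Prop :=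
  ∀ x, Filter.Tendsto (fun k => OneCell.phi k ((η.seq k).app (Γ.obj k)) x) Filter.atTop
    (nhds (T x))

open Classical in
/-- `PB(η)`: the strong operator limit of the operators `Φ_{η^(k)}`. -/
def BQFS.PB (η : BQFS R Λ Ω) : Λ.H →L[ℂ] Ω.H :=
  if h : ∃ T, η.IsLimit T then h.choose else 0

end TwoCells

end

noncomputable section

open CStarCategory SemisimpleCStarCategory

/-! ### Traces and matrix coefficients over the simple objects -/

section Traces

variable {C : Type u} [SemisimpleCStarCategory.{v} C]

/-! The loop operator is a conditional expectation. Traciality of the solution says that `ρ'† Δ'(·)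
ρ'` preserves the weighted traces (`TracialSolution.catTr_partialTr`). Hence `Φ_{Sφ}` and `Φ_φ` have
the same scalar products between vectors of level `k` (`inner_phi_loop`). A BQFS therefore yields a
bounded martingale of operators: on a vector of level `k` the increments are orthogonal, so the
squared norms increase and stay bounded, and the sequence is Cauchy. The uniform bound carries this
to all of `H` (`BQFS.cauchySeq_op`).

At level `n` the operator `Φ_{η^(n)}` commutes with `A_n` by naturality and with `B_n` by
associativity, so the strong limit commutes with `A_∞` and `B_∞`. The von Neumann algebras are
reached by normality: an ultraweakly continuous functional vanishing on a unital `*`-algebra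
vanishes on its bicommutant (`tsum_inner_eq_zero_of_bicommutant`).

For the product, uniformly bounded strong limits multiply, so the scalar products at level `k` of `S
⋯ S (κ ∘ η)` converge to those of `PB(κ) PB(η)`. Bi-faithfulness makes every simple object occur in
`Γ_k ⋯ Γ_1 m_0` and in `Δ_k ⋯ Δ_1 n_0`, so these scalar products contain all matrix coefficients of
a natural transformation (`exists_coeff_eq_inner`). There are finitely many coefficients on simple
objects, and the simple components control the norm on every object (`norm_app_le`), so weak
convergence becomes convergence in C*-norm. The limit at level `k` is the compression of `PB(κ)
PB(η)` to that level. Compressions of one operator are compatible, which gives quasi-flatness, and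
they determine the operator, which gives the product formula. -/

theorem onbCard_simple_self (w : V C) : onbCard (simple w : C) w = 1 := by
  rw [onbCard_eq_finrank]
  exact finrank_eq_one (𝟙 (simple w)) (simple_ne_zero w) fun f =>
    ⟨scal f, (scal_spec f).symm⟩

theorem onbCard_simple_of_ne {w x : V C} (h : x ≠ w) : onbCard (simple w : C) x = 0 := by
  rw [onbCard_eq_finrank]
  have : Subsingleton ((simple x : C) ⟶ simple w) :=
    ⟨fun f g => (simple_hom x w h f).trans (simple_hom x w h g).symm⟩
  exact Module.finrank_zero_of_subsingleton

theorem catTr_simple_id (μ : V C → ℝ) (w : V C) :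
    catTr μ (simple w) (𝟙 (simple w)) = (μ w : ℂ) := by
  have h : ∀ x, ∑ a, (μ x : ℂ) * scal (onb (simple w) x a ≫ 𝟙 _ ≫ dag (onb (simple w) x a)) =
      (onbCard (simple w : C) x : ℂ) * μ x := by
    intro x
    simp [onb_orth, scal_id]
  rw [catTr]
  simp only [h]
  rw [Finset.sum_eq_single w]
  · simp [onbCard_simple_self]
  · intro x _ hx
    simp [onbCard_simple_of_ne hx]
  · simp

theorem catTr_simple (μ : V C → ℝ) {w : V C} (f : (simple w : C) ⟶ simple w) :
    catTr μ (simple w) f = scal f * μ w := by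
  conv_lhs => rw [scal_spec f]
  rw [catTr_smul, catTr_simple_id]

/-- A morphism is determined by its matrix coefficients. -/
theorem eq_sum_coeff {X Y : C} (f : X ⟶ Y) :
    f = ∑ w, ∑ a, ∑ b, scal (onb X w a ≫ f ≫ dag (onb Y w b)) •
      (dag (onb X w a) ≫ onb Y w b) := by
  classical
  have key : ∀ w a, onb X w a ≫ f =
      ∑ b, scal (onb X w a ≫ f ≫ dag (onb Y w b)) • onb Y w b := by
    intro w a
    conv_lhs => rw [← Category.comp_id (onb X w a ≫ f), ← onb_sum Y]
    rw [Preadditive.comp_sum, Finset.sum_eq_single w]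
    · rw [Preadditive.comp_sum]
      refine Finset.sum_congr rfl fun b _ => ?_
      rw [← Category.assoc, Category.assoc (onb X w a) f,
        scal_spec (onb X w a ≫ f ≫ dag (onb Y w b)), Linear.smul_comp, Category.id_comp,
        ← scal_spec]
    · intro x _ hx
      rw [Preadditive.comp_sum]
      refine Finset.sum_eq_zero fun b _ => ?_
      rw [← Category.assoc, simple_hom w x hx.symm ((onb X w a ≫ f) ≫ dag (onb Y x b))]
      exact Limits.zero_comp
    · simp
  conv_lhs => rw [← Category.id_comp f, ← onb_sum X]
  rw [Preadditive.sum_comp]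
  refine Finset.sum_congr rfl fun w _ => ?_
  rw [Preadditive.sum_comp]
  refine Finset.sum_congr rfl fun a _ => ?_
  rw [Category.assoc, key, Preadditive.comp_sum]
  exact Finset.sum_congr rfl fun b _ => Linear.comp_smul _ _ _ _ _ _

/-- If `Hom(v, X)` vanishes for all simple `v`, then `X` is a zero object. -/
theorem id_eq_zero_of_forall_simple {X : C} (h : ∀ (v : V C) (f : simple v ⟶ X), f = 0) :
    𝟙 X = 0 := by
  rw [← onb_sum X]
  refine Finset.sum_eq_zero fun v _ => Finset.sum_eq_zero fun a _ => ?_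
  rw [h v (onb X v a)]
  exact Limits.comp_zero

/-- On a simple source `f ≫ dag f` is the scalar `‖f‖²`, so normalising `f` suffices. -/
theorem exists_isometry_of_ne_zero {v : V C} {X : C} {f : simple v ⟶ X} (hf : f ≠ 0) :
    ∃ g : simple v ⟶ X, g ≫ dag g = 𝟙 (simple v) := by
  have hn : ‖f‖ ≠ 0 := norm_ne_zero_iff.2 hf
  refine ⟨((‖f‖⁻¹ : ℝ) : ℂ) • f, ?_⟩
  rw [dag_smul, Linear.smul_comp, Linear.comp_smul, scal_spec (f ≫ dag f), scal_comp_dag,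
    smul_smul, smul_smul, Complex.conj_ofReal, ← Complex.ofReal_mul, ← Complex.ofReal_mul]
  have : ‖f‖⁻¹ * ‖f‖⁻¹ * ‖f‖ ^ 2 = 1 := by field_simp
  rw [this, Complex.ofReal_one, one_smul]

end Traces

/-! ### Occurrence of all simple objects -/

/-- A bi-faithful functor hits every simple object. -/
theorem BiFaithful.exists_isometry {C : Type u₁} [SemisimpleCStarCategory.{v₁} C] {D : Type u₂}
    [SemisimpleCStarCategory.{v₂} D] {F : C ⥤ D} (hF : BiFaithful F) (w : V D) :
    ∃ (v : V C) (s : simple w ⟶ F.obj (simple v)), s ≫ dag s = 𝟙 (simple w) := by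
  obtain ⟨-, G, ⟨adj⟩, hG⟩ := hF
  -- If `w` embeds in no `F v`, then taking adjoints `Hom(F v, w) = 0`, hence `Hom(v, G w) = 0` for
  -- all simple `v`. So `G w` is a zero object, which contradicts faithfulness of `G` at `𝟙 w`.
  by_contra! hc
  have h0 : ∀ (v : V C) (f : F.obj (simple v) ⟶ simple w), f = 0 := by
    intro v f
    by_contra hf
    have : dag f ≠ 0 := fun h => hf (by rw [← dag_dag f, h, dag_zero])
    obtain ⟨g, hg⟩ := exists_isometry_of_ne_zero this
    exact hc v g hg
  have h1 : 𝟙 (G.obj (simple w)) = 0 := id_eq_zero_of_forall_simple fun v f => by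
    apply (adj.homEquiv _ _).symm.injective
    exact (h0 v _).trans (h0 v _).symm
  have h2 : ∀ f : G.obj (simple w) ⟶ G.obj (simple w), f = 0 := fun f => by
    rw [← Category.comp_id f, h1, Limits.comp_zero]
  exact simple_ne_zero w (G.map_injective ((h2 _).trans (h2 _).symm))

/-- At level `0` these are the summand inclusions of `m₀`. At the next level, embed `w` in some `Γ
v` and apply `Γ` to an isometry out of `v`. -/
theorem ZeroCell.exists_isometry (Γ : ZeroCell.{v, u}) :
    ∀ (k : ℕ) (v : V (Γ.M k)), ∃ s : simple v ⟶ Γ.obj k, s ≫ dag s = 𝟙 (simple v)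
  | 0, v => by
    obtain ⟨ι, h, -⟩ := (exists_sum (V (Γ.M 0)) (fun v => (simple v : Γ.M 0))).choose_spec
    exact ⟨ι v, h v⟩
  | k + 1, w => by
    obtain ⟨v, s, hs⟩ := (Γ.biFaithful k).exists_isometry w
    obtain ⟨t, ht⟩ := ZeroCell.exists_isometry Γ k v
    refine ⟨s ≫ (Γ.Γ k).map t, ?_⟩
    change (s ≫ (Γ.Γ k).map t) ≫ dag (X := simple w) (Y := (Γ.Γ k).obj (Γ.obj k))
      (s ≫ (Γ.Γ k).map t) = _
    rw [dag_comp, ← StarFunctor.map_dag, Category.assoc, ← Category.assoc ((Γ.Γ k).map t),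
      ← Functor.map_comp, ht, CategoryTheory.Functor.map_id, Category.id_comp, hs]

/-! ### Natural transformations as block diagonal families over the simple objects -/

section BlockDiagonal

variable {C : Type u₁} [SemisimpleCStarCategory.{v₁} C] {D : Type u₂}
    [SemisimpleCStarCategory.{v₂} D] {F G K : StarFunctor C D}

theorem onb_orth_of_ne (X : C) {v w : V C} (h : v ≠ w) (a : Fin (onbCard X v))
    (b : Fin (onbCard X w)) : onb X v a ≫ dag (onb X w b) = 0 :=
  simple_hom v w h _

/-- The morphism `F X → G X` obtained from morphisms `F v → G v` for simple `v`. -/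
def blockDiag (f : ∀ v : V C, F.obj (simple v) ⟶ G.obj (simple v)) (X : C) :
    F.obj X ⟶ G.obj X :=
  ∑ v, ∑ a, F.map (dag (onb X v a)) ≫ f v ≫ G.map (onb X v a)

/-- Naturality applied to the resolution of `𝟙 X` by an orthonormal basis. -/
theorem app_eq_blockDiag (φ : F.toFunctor ⟶ G.toFunctor) (X : C) :
    φ.app X = blockDiag (fun v => φ.app (simple v)) X := by
  have h : ∀ v a, F.map (dag (onb X v a)) ≫ φ.app (simple v) ≫ G.map (onb X v a) =
      F.map (dag (onb X v a) ≫ onb X v a) ≫ φ.app X := by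
    intro v a
    rw [← φ.naturality, F.map_comp, Category.assoc]
  simp only [blockDiag, h, ← Preadditive.sum_comp, ← F.map_sum, onb_sum, F.map_id,
    Category.id_comp]

theorem blockDiag_add (f g : ∀ v : V C, F.obj (simple v) ⟶ G.obj (simple v)) (X : C) :
    blockDiag (f + g) X = blockDiag f X + blockDiag g X := by
  simp only [blockDiag, Pi.add_apply, Preadditive.add_comp, Preadditive.comp_add,
    Finset.sum_add_distrib]

theorem blockDiag_smul (r : ℂ) (f : ∀ v : V C, F.obj (simple v) ⟶ G.obj (simple v)) (X : C) :
    blockDiag (r • f) X = r • blockDiag f X := by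
  simp only [blockDiag, Pi.smul_apply, Linear.smul_comp, Linear.comp_smul, Finset.smul_sum]

theorem dag_blockDiag (f : ∀ v : V C, F.obj (simple v) ⟶ G.obj (simple v)) (X : C) :
    dag (blockDiag f X) = blockDiag (fun v => dag (f v)) X := by
  simp only [blockDiag, dag_sum, dag_comp, F.map_dag, G.map_dag, dag_dag, Category.assoc]

/-- Orthonormality kills the cross terms. For `F = G = K` this is the multiplicativity behind
`norm_app_le`. -/
theorem blockDiag_comp (f : ∀ v : V C, F.obj (simple v) ⟶ G.obj (simple v))
    (g : ∀ v : V C, G.obj (simple v) ⟶ K.obj (simple v)) (X : C) :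
    blockDiag f X ≫ blockDiag g X = blockDiag (fun v => f v ≫ g v) X := by
  classical
  have h : ∀ v a, G.map (onb X v a) ≫ blockDiag g X = g v ≫ K.map (onb X v a) := by
    intro v a
    have h' : ∀ w b, G.map (onb X v a) ≫ G.map (dag (onb X w b)) ≫ g w ≫ K.map (onb X w b) =
        G.map (onb X v a ≫ dag (onb X w b)) ≫ g w ≫ K.map (onb X w b) := by
      intro w b
      rw [G.map_comp, Category.assoc]
    have h0 : ∀ {X Y : C}, G.map (0 : X ⟶ Y) = 0 := by
      intro X Y
      simpa using G.map_smul' 0 (0 : X ⟶ Y)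
    simp only [blockDiag, Preadditive.comp_sum, h']
    rw [Finset.sum_eq_single v, Finset.sum_eq_single a]
    · rw [onb_orth, if_pos rfl, G.map_id, Category.id_comp]
    · intro b _ hb
      rw [onb_orth, if_neg hb.symm, h0, Limits.zero_comp]
    · simp
    · intro w _ hw
      refine Finset.sum_eq_zero fun b _ => ?_
      rw [onb_orth_of_ne X hw.symm, h0, Limits.zero_comp]
    · simp
  conv_lhs => rw [blockDiag]
  simp only [Preadditive.sum_comp, Category.assoc, h]
  simp only [blockDiag, Category.assoc]

/-- A natural transformation between `*`-linear functors is dominated by its components on the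
simple objects. -/
theorem norm_app_le (φ : F.toFunctor ⟶ G.toFunctor) {c : ℝ} (hc : 0 ≤ c)
    (h : ∀ v : V C, ‖φ.app (simple v)‖ ≤ c) (X : C) : ‖φ.app X‖ ≤ c := by
  -- A `*`-homomorphism from a finite product of C*-algebras is contractive. Applying it to the
  -- blocks of `φ ≫ dag φ` and using the C*-identity reduces different source and target functors to
  -- endomorphisms.
  let ψ : (∀ v : V C, EndAlg (F.obj (simple v))) →⋆ₙₐ[ℂ] EndAlg (F.obj X) :=
    { toFun := fun f => blockDiag (F := F) (G := F) f X
      map_smul' := fun r f => blockDiag_smul (F := F) (G := F) r f X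
      map_zero' := by
        have h0 : blockDiag (F := F) (G := F) 
            (0 : ∀ v : V C, F.obj (simple v) ⟶ F.obj (simple v)) X = 0 := by
          simpa using blockDiag_smul (F := F) (G := F) 0 0 X
        exact h0
      map_add' := fun f g => blockDiag_add (F := F) (G := F) f g X
      map_mul' := fun f g => (blockDiag_comp (F := F) (G := F) (K := F) g f X).symm
      map_star' := fun f => (dag_blockDiag (F := F) (G := F) f X).symm }
  let f : ∀ v : V C, EndAlg (F.obj (simple v)) := fun v =>
    φ.app (simple v) ≫ dag (φ.app (simple v))
  have hψ : ψ f = φ.app X ≫ dag (φ.app X) := by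
    rw [app_eq_blockDiag φ X, dag_blockDiag, blockDiag_comp]
    rfl
  have h₁ : ‖ψ f‖ ≤ ‖f‖ := NonUnitalStarAlgHom.norm_apply_le ψ f
  have h₂ : ‖f‖ ≤ c * c := (pi_norm_le_iff_of_nonneg (by positivity)).2 fun v =>
    (norm_comp_dag (φ.app (simple v))).le.trans
      (mul_le_mul (h v) (h v) (norm_nonneg _) hc)
  have h₃ : ‖φ.app X‖ * ‖φ.app X‖ ≤ c * c := by
    rw [← norm_comp_dag]
    refine le_trans (le_of_eq ?_) (h₁.trans h₂)
    rw [hψ]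
    rfl
  exact abs_le_of_sq_le_sq' (by nlinarith) hc |>.2

end BlockDiagonal

/-! ### The partial trace of a tracial solution -/

section Loops

variable {C : Type u₁} [SemisimpleCStarCategory.{v₁} C] {D : Type u₂}
    [SemisimpleCStarCategory.{v₂} D] {F : StarFunctor C D} {μ : V C → ℝ} {ν : V D → ℝ}
    (R : TracialSolution F μ ν)

namespace TracialSolution

/-- `ρ'† ∘ F'(f) ∘ ρ'` for `f : F X → F Y`. -/
def partialTr {X Y : C} (f : F.obj X ⟶ F.obj Y) : X ⟶ Y :=
  (R.rho'.app X : X ⟶ R.bar.obj (F.obj X)) ≫ R.bar.map f ≫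
    dag (R.rho'.app Y : Y ⟶ R.bar.obj (F.obj Y))

/-- Naturality of `rho'`. Together with `partialTr_comp_map` it gives the bimodule property of a
conditional expectation. -/
theorem map_comp_partialTr {X Y Z : C} (g : X ⟶ Y) (f : F.obj Y ⟶ F.obj Z) :
    R.partialTr (F.map g ≫ f) = g ≫ R.partialTr f := by
  have h := R.rho'.naturality g
  simp only [Functor.comp_map, Functor.id_map] at h
  unfold partialTr
  rw [R.bar.map_comp, ← Category.assoc g, h, Category.assoc, ← Category.assoc]

theorem dag_partialTr {X Y : C} (f : F.obj X ⟶ F.obj Y) :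
    dag (R.partialTr f) = R.partialTr (dag f) := by
  unfold partialTr
  rw [dag_comp, dag_comp, dag_dag, R.bar.map_dag]
  exact Category.assoc _ _ _

theorem partialTr_comp_map {X Y Z : C} (f : F.obj X ⟶ F.obj Y) (g : Y ⟶ Z) :
    R.partialTr (f ≫ F.map g) = R.partialTr f ≫ g := by
  rw [← dag_dag (R.partialTr (f ≫ F.map g)), dag_partialTr, dag_comp, ← F.map_dag,
    map_comp_partialTr, dag_comp, dag_dag, dag_partialTr, dag_dag]

theorem partialTr_sum {X Y : C} {ι : Type*} (s : Finset ι) (f : ι → (F.obj X ⟶ F.obj Y)) :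
    R.partialTr (∑ i ∈ s, f i) = ∑ i ∈ s, R.partialTr (f i) := by
  unfold partialTr
  rw [StarFunctor.map_sum]
  exact (congrArg (_ ≫ ·) (Preadditive.sum_comp _ _ _)).trans (Preadditive.comp_sum _ _ _)

theorem partialTr_smul {X Y : C} (r : ℂ) (f : F.obj X ⟶ F.obj Y) :
    R.partialTr (r • f) = r • R.partialTr f := by
  unfold partialTr
  rw [R.bar.map_smul']
  exact (congrArg (_ ≫ ·) (Linear.smul_comp _ _ _ _ _ _)).trans (Linear.comp_smul _ _ _ _ _ _)

/-- Expand `f` in matrix units `dag τ ≫ σ`. The tracial condition annihilates the off-diagonal ones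
and gives `ν w / μ v` on each diagonal one. -/
theorem partialTr_simple {v : V C}
    (f : F.obj (simple v : C) ⟶ F.obj (simple v : C)) :
    R.partialTr f = (catTr ν _ f / μ v) • 𝟙 (simple v : C) := by
  conv_lhs => rw [eq_sum_coeff f]
  rw [partialTr_sum, catTr, Finset.sum_div, Finset.sum_smul]
  refine Finset.sum_congr rfl fun w _ => ?_
  rw [partialTr_sum, Finset.sum_div, Finset.sum_smul]
  refine Finset.sum_congr rfl fun a _ => ?_
  rw [partialTr_sum, Finset.sum_eq_single a]
  · rw [partialTr_smul]
    have := R.tracial v w (onb _ w a) (onb _ w a)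
    rw [partialTr, this, onb_orth, if_pos rfl, scal_id, smul_smul]
    congr 1
    push_cast
    ring
  · intro b _ hb
    have := R.tracial v w (onb _ w b) (onb _ w a)
    rw [partialTr_smul, partialTr, this, onb_orth, if_neg hb, scal_zero, mul_zero, zero_smul,
      smul_zero]
  · simp

/-- Cut `X` into simple pieces: the weight `μ v` of each piece cancels the denominator in
`partialTr_simple`. -/
theorem catTr_partialTr (hμ : ∀ v, 0 < μ v) {X : C} (f : F.obj X ⟶ F.obj X) :
    catTr μ X (R.partialTr f) = catTr ν (F.obj X) f := by
  have h : f = ∑ v, ∑ a, F.map (dag (onb X v a)) ≫ F.map (onb X v a) ≫ f := by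
    simp only [← Category.assoc, ← F.map_comp]
    simp only [← F.map_sum, ← Preadditive.sum_comp, onb_sum, F.map_id, Category.id_comp]
  conv_rhs => rw [h]
  rw [catTr, catTr_sum]
  refine Finset.sum_congr rfl fun v _ => ?_
  rw [catTr_sum]
  refine Finset.sum_congr rfl fun a _ => ?_
  rw [← partialTr_comp_map, ← map_comp_partialTr, partialTr_simple R, scal_eq rfl, mul_div_cancel₀,
    catTr_comm, Category.assoc, catTr_comm, Category.assoc, catTr_comm]
  exact_mod_cast (hμ v).ne'

/-- The left side is the partial trace of the identity. On a simple `v` it is `Tr(𝟙) / μ v`, which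
is `1` by compatibility of the weights. -/
theorem rho'_isometry (hμ : ∀ v, 0 < μ v)
    (h : ∀ v, ∑ w, (adj F.toFunctor w v : ℝ) * ν w = μ v) (X : C) :
    (R.rho'.app X : X ⟶ R.bar.obj (F.obj X)) ≫
      dag (R.rho'.app X : X ⟶ R.bar.obj (F.obj X)) = 𝟙 X := by
  have h0 : ∀ X : C, R.partialTr (𝟙 (F.obj X)) = (R.rho'.app X : X ⟶ R.bar.obj (F.obj X)) ≫
      dag (R.rho'.app X : X ⟶ R.bar.obj (F.obj X)) := by
    intro X
    rw [partialTr, R.bar.map_id]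
    exact congrArg (_ ≫ ·) (Category.id_comp _)
  rw [← h0, ← F.map_id, ← onb_sum X, F.map_sum, partialTr_sum]
  refine Finset.sum_congr rfl fun v _ => ?_
  rw [F.map_sum, partialTr_sum]
  refine Finset.sum_congr rfl fun a _ => ?_
  rw [F.map_comp, map_comp_partialTr, ← Category.id_comp (F.map (onb X v a)), partialTr_comp_map,
    partialTr_simple R, ← F.map_id, catTr_map F μ ν h, catTr_simple_id, div_self, one_smul,
    Category.id_comp]
  exact_mod_cast (hμ v).ne'

theorem norm_partialTr_le (hμ : ∀ v, 0 < μ v)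
    (h : ∀ v, ∑ w, (adj F.toFunctor w v : ℝ) * ν w = μ v) {X Y : C}
    (f : F.obj X ⟶ F.obj Y) : ‖R.partialTr f‖ ≤ ‖f‖ := by
  have h₁ := norm_le_one_of_isometry _ (R.rho'_isometry hμ h X)
  have h₂ := norm_le_one_of_isometry _ (R.rho'_isometry hμ h Y)
  rw [← norm_dag] at h₂
  refine (norm_comp_le _ _).trans ?_
  refine (mul_le_mul h₁ (norm_comp_le _ _) (norm_nonneg _) zero_le_one).trans ?_
  rw [one_mul]
  refine (mul_le_mul (R.bar.norm_map_le f) h₂ (norm_nonneg _) (norm_nonneg _)).trans ?_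
  rw [mul_one]

end TracialSolution

end Loops

/-! ### Ultraweakly continuous functionals and the bicommutant -/

section Bicommutant

theorem memℓp_two_iff {K : Type*} [NormedAddCommGroup K] {ι : Type*} {x : ι → K} :
    Memℓp x 2 ↔ Summable fun i => ‖x i‖ ^ 2 := by
  rw [memℓp_gen_iff (by norm_num)]
  simp

theorem lp_two_norm_sq {K : Type*} [NormedAddCommGroup K] {ι : Type*}
    (f : lp (fun _ : ι => K) 2) : ‖f‖ ^ 2 = ∑' i, ‖f i‖ ^ 2 := by
  have := lp.norm_rpow_eq_tsum (p := 2) (by norm_num) f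
  simpa using this

variable {K : Type*} [NormedAddCommGroup K] [InnerProductSpace ℂ K] {ι : Type*}

theorem memℓp_two_map (s : K →L[ℂ] K) (f : lp (fun _ : ι => K) 2) :
    Memℓp (fun i => s (f i)) 2 := by
  rw [memℓp_two_iff]
  refine Summable.of_nonneg_of_le (fun i => by positivity) (fun i => ?_)
    ((memℓp_two_iff.1 (lp.memℓp f)).mul_left (‖s‖ ^ 2))
  rw [← mul_pow]
  gcongr
  exact s.le_opNorm _

/-- The diagonal action `s ⊗ 1` of an operator `s` on `ℓ²(ι, K)`. -/
def amplify (ι : Type*) (s : K →L[ℂ] K) :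
    lp (fun _ : ι => K) 2 →L[ℂ] lp (fun _ : ι => K) 2 :=
  LinearMap.mkContinuous
    { toFun := fun f => ⟨fun i => s (f i), memℓp_two_map s f⟩
      map_add' := fun f g => by ext i; exact map_add s _ _
      map_smul' := fun r f => by ext i; simp } ‖s‖ fun f => by
    refine abs_le_of_sq_le_sq' ?_ (by positivity) |>.2
    rw [mul_pow, lp_two_norm_sq, lp_two_norm_sq, ← tsum_mul_left]
    refine Summable.tsum_le_tsum (fun i => ?_) (memℓp_two_iff.1 (memℓp_two_map s f))
      ((memℓp_two_iff.1 (lp.memℓp f)).mul_left (‖s‖ ^ 2))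
    rw [← mul_pow]
    gcongr
    exact s.le_opNorm _

@[simp]
theorem amplify_apply (s : K →L[ℂ] K) (f : lp (fun _ : ι => K) 2) (i : ι) :
    amplify ι s f i = s (f i) := rfl

theorem inner_amplify_right [CompleteSpace K] (s : K →L[ℂ] K) (f g : lp (fun _ : ι => K) 2) :
    inner ℂ f (amplify ι s g) = inner ℂ (amplify ι (star s) f) g := by
  rw [lp.inner_eq_tsum, lp.inner_eq_tsum]
  refine tsum_congr fun i => ?_
  rw [amplify_apply, amplify_apply, ContinuousLinearMap.star_eq_adjoint,
    ContinuousLinearMap.adjoint_inner_left]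

theorem amplify_single [DecidableEq ι] (s : K →L[ℂ] K) (i : ι) (z : K) :
    amplify ι s (lp.single 2 i z) = lp.single 2 i (s z) := by
  ext j
  rw [amplify_apply, lp.single_apply, lp.single_apply]
  by_cases h : j = i
  · subst h; simp
  · simp [h]

/-- An operator commuting with the amplifications of `A` commutes with those of the bicommutant
of `A`. -/
theorem amplify_comm_of_bicommutant [CompleteSpace K] (A : StarSubalgebra ℂ (K →L[ℂ] K))
    (P : lp (fun _ : ι => K) 2 →L[ℂ] lp (fun _ : ι => K) 2)
    (hP : ∀ s ∈ A, amplify ι s ∘L P = P ∘L amplify ι s) {a : K →L[ℂ] K}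
    (ha : a ∈ StarSubalgebra.centralizer ℂ
      (StarSubalgebra.centralizer ℂ (A : Set (K →L[ℂ] K)) : Set (K →L[ℂ] K))) :
    amplify ι a ∘L P = P ∘L amplify ι a := by
  classical
  refine lp.ext_continuousLinearMap (by norm_num) fun i => ?_
  ext z j
  -- The `(j, i)` matrix entry of `P`. Commuting with all `s ⊗ 1` puts every entry in the commutant
  -- of `A`, hence every entry commutes with `a`.
  let q : K →L[ℂ] K := lp.evalCLM ℂ (fun _ : ι => K) 2 j ∘L P ∘L
    lp.singleContinuousLinearMap ℂ (fun _ : ι => K) 2 i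
  have hq : ∀ z, q z = P (lp.single 2 i z) j := fun z => rfl
  have hs : ∀ s ∈ A, s * q = q * s := by
    intro s hs
    ext z
    have := congrArg (fun T => T (lp.single 2 i z) j) (hP s hs)
    simpa [hq, amplify_single] using this
  have hqc : q ∈ StarSubalgebra.centralizer ℂ (A : Set (K →L[ℂ] K)) :=
    StarSubalgebra.mem_centralizer_iff ℂ |>.2 fun s h => ⟨hs s h, hs _ (star_mem h)⟩
  have := congrArg (fun T : K →L[ℂ] K => T z)
    ((StarSubalgebra.mem_centralizer_iff ℂ |>.1 ha q hqc).1)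
  simp only [mul_apply_eq_comp, hq] at this
  simp [amplify_single, this]

/-- An ultraweakly continuous functional vanishing on a unital `*`-algebra of operators vanishes on
its bicommutant. -/
theorem tsum_inner_eq_zero_of_bicommutant [CompleteSpace K] (A : StarSubalgebra ℂ (K →L[ℂ] K))
    {x y : ι → K} (hx : Summable fun i => ‖x i‖ ^ 2) (hy : Summable fun i => ‖y i‖ ^ 2)
    (h : ∀ s ∈ A, ∑' i, inner ℂ (y i) (s (x i)) = 0) {a : K →L[ℂ] K}
    (ha : a ∈ StarSubalgebra.centralizer ℂ
      (StarSubalgebra.centralizer ℂ (A : Set (K →L[ℂ] K)) : Set (K →L[ℂ] K))) :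
    ∑' i, inner ℂ (y i) (a (x i)) = 0 := by
  let X : lp (fun _ : ι => K) 2 := ⟨x, memℓp_two_iff.2 hx⟩
  let Y : lp (fun _ : ι => K) 2 := ⟨y, memℓp_two_iff.2 hy⟩
  have hXY : ∀ s : K →L[ℂ] K, inner ℂ Y (amplify ι s X) = ∑' i, inner ℂ (y i) (s (x i)) :=
    fun s => lp.inner_eq_tsum _ _
  -- The orbit of `X` under `A ⊗ 1`. By hypothesis `Y` is orthogonal to it, so it suffices that `(a
  -- ⊗ 1) X` lies in its closure `M`. This follows once `a ⊗ 1` commutes with the projection onto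
  -- `M`.
  let M₀ : Submodule ℂ (lp (fun _ : ι => K) 2) :=
    { carrier := {z | ∃ s ∈ A, amplify ι s X = z}
      add_mem' := by
        rintro _ _ ⟨s, hs, rfl⟩ ⟨t, ht, rfl⟩
        exact ⟨s + t, add_mem hs ht, by ext i; simp⟩
      zero_mem' := ⟨0, zero_mem _, by ext i; simp⟩
      smul_mem' := by
        rintro r _ ⟨s, hs, rfl⟩
        exact ⟨r • s, A.smul_mem hs r, by ext i; simp⟩ }
  let M := M₀.topologicalClosure
  have hinv : ∀ s ∈ A, ∀ z ∈ M, amplify ι s z ∈ M := by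
    intro s hs z hz
    refine map_mem_closure (amplify ι s).continuous hz ?_
    rintro _ ⟨t, ht, rfl⟩
    exact ⟨s * t, mul_mem hs ht, by ext i; simp⟩
  have hMc : IsClosed (M : Set (lp (fun _ : ι => K) 2)) := M₀.isClosed_topologicalClosure
  have : CompleteSpace M := hMc.completeSpace_coe
  have hcomm : ∀ s ∈ A, amplify ι s ∘L M.starProjection = M.starProjection ∘L amplify ι s := by
    intro s hs
    ext1 z
    -- Since `A` is closed under `star`, the orthogonal complement of `M` is invariant too.
    refine (Submodule.eq_starProjection_of_mem_of_inner_eq_zero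
      (hinv s hs _ (Submodule.starProjection_apply_mem M z)) fun w hw => ?_).symm
    have h0 := Submodule.starProjection_inner_eq_zero (K := M) z (amplify ι (star s) w)
      (hinv _ (star_mem hs) w hw)
    change inner ℂ (amplify ι s z - amplify ι s (M.starProjection z)) w = 0
    rw [← map_sub, ← inner_conj_symm, inner_amplify_right, inner_conj_symm]
    exact h0
  -- This is where the unit of `A` is needed.
  have hXM : X ∈ M := subset_closure ⟨1, one_mem _, by ext i; simp⟩
  have haX : amplify ι a X ∈ M := by
    have := congrArg (fun T => T X) (amplify_comm_of_bicommutant A _ hcomm ha)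
    simp only [ContinuousLinearMap.comp_apply, Submodule.starProjection_eq_self_iff.2 hXM] at this
    rw [this]
    exact Submodule.starProjection_apply_mem _ _
  rw [← hXY]
  have hcl : IsClosed {z | inner ℂ Y z = (0 : ℂ)} :=
    isClosed_eq (by fun_prop) continuous_const
  refine closure_minimal (t := {z | inner ℂ Y z = (0 : ℂ)}) ?_ hcl haX
  rintro _ ⟨s, hs, rfl⟩
  exact (hXY s).trans (h s hs)

end Bicommutant

/-! ### Density of the levels in the completion -/

namespace HilbertTower

variable (S : HilbertTower.{v})

theorem ι_trans (i j : ℕ) (h : i ≤ j) (x : S.E i) : S.ι j (S.trans i j h x) = S.ι i x :=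
  congrArg ((↑) : S.Alg → S.H) (S.of_trans i j h x)

theorem ι_incl (k : ℕ) (x : S.E k) : S.ι (k + 1) (S.incl k x) = S.ι k x :=
  congrArg ((↑) : S.Alg → S.H) (S.of_incl k x)

theorem inner_ι (k : ℕ) (x y : S.E k) :
    inner ℂ (S.ι k x) (S.ι k y) = (S.core k).inner x y :=
  (UniformSpace.Completion.inner_coe _ _).trans (S.inner_of k x y)

/-- The image of `E k` in the completion. -/
def level (k : ℕ) : Submodule ℂ S.H := LinearMap.range (S.ι k)

theorem dense_level : Dense {x : S.H | ∃ k, x ∈ S.level k} := by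
  refine UniformSpace.Completion.denseRange_coe.mono ?_
  rintro _ ⟨z, rfl⟩
  obtain ⟨k, x, -, rfl, -⟩ := S.exists_of₂ z z
  exact ⟨k, x, rfl⟩

variable {S}

/-- The levels increase to a dense subspace, so any initial segment of them may be skipped. This
suits operators that have a formula only from level `k` on. -/
theorem eq_of_forall_level {E : Type*} [TopologicalSpace E] [T2Space E] {f g : S.H → E}
    (hf : Continuous f) (hg : Continuous g) (k : ℕ)
    (h : ∀ m, k ≤ m → ∀ x, f (S.ι m x) = g (S.ι m x)) : f = g := by
  refine Continuous.ext_on S.dense_level hf hg ?_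
  rintro _ ⟨l, x, rfl⟩
  rw [← S.ι_trans l (max k l) (le_max_right _ _)]
  exact h _ (le_max_left _ _) _

theorem forall_of_level {p : S.H → Prop} (hp : IsClosed {x | p x}) (k : ℕ)
    (h : ∀ m, k ≤ m → ∀ x, p (S.ι m x)) (x : S.H) : p x := by
  refine S.dense_level.induction ?_ hp x
  rintro _ ⟨l, x, rfl⟩
  rw [← S.ι_trans l (max k l) (le_max_right _ _)]
  exact h _ (le_max_left _ _) _

/-- A vector is determined by its scalar products with the elements of the `E m`, `m ≥ k`. -/
theorem eq_of_inner_level {x y : S.H} (k : ℕ)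
    (h : ∀ m, k ≤ m → ∀ z, inner ℂ (S.ι m z) x = inner ℂ (S.ι m z) y) : x = y := by
  refine ext_inner_left ℂ fun w => ?_
  exact congrFun (eq_of_forall_level (f := fun w => inner ℂ w x) (g := fun w => inner ℂ w y)
    (by fun_prop) (by fun_prop) k h) w

end HilbertTower

/-! ### The operators `Φ_γ` on the levels of the bimodule -/

namespace OneCell

variable {Γ : ZeroCell.{v₁, u₁}} {Δ : ZeroCell.{v₂, u₂}} (Λ : OneCell Γ Δ)
  {Ω Ξ : OneCell Γ Δ}

theorem inner_ι (k : ℕ) (x y : Δ.obj k ⟶ (Λ.F k).obj (Γ.obj k)) :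
    inner ℂ (Λ.ι k x) (Λ.ι k y) = catTr (Δ.μ k) _ (y ≫ dag x) :=
  Λ.tower.inner_ι k x y

theorem ι_incl (k : ℕ) (x : Δ.obj k ⟶ (Λ.F k).obj (Γ.obj k)) :
    Λ.ι (k + 1) ((Δ.Γ k).map x ≫ (Λ.W k).app (Γ.obj k)) = Λ.ι k x :=
  Λ.tower.ι_incl k x

theorem exists_ι_of_le {k m : ℕ} (h : k ≤ m) (x : Δ.obj k ⟶ (Λ.F k).obj (Γ.obj k)) :
    ∃ y, Λ.ι m y = Λ.ι k x :=
  ⟨_, Λ.tower.ι_trans k m h x⟩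

theorem norm_ι_comp_le (k : ℕ) (x : Δ.obj k ⟶ (Λ.F k).obj (Γ.obj k))
    (γ : (Λ.F k).obj (Γ.obj k) ⟶ (Ω.F k).obj (Γ.obj k)) :
    ‖Ω.ι k (x ≫ γ)‖ ≤ ‖γ‖ * ‖Λ.ι k x‖ := by
  refine abs_le_of_sq_le_sq' ?_ (by positivity) |>.2
  rw [mul_pow, norm_sq_eq_re_inner (𝕜 := ℂ) (Ω.ι k _),
    norm_sq_eq_re_inner (𝕜 := ℂ) (Λ.ι k x), inner_ι, inner_ι]
  exact catTr_comp_le (Δ.μ k) (Δ.μ_pos k) x γ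

variable {Λ}

theorem phi_ι (k : ℕ) (γ : (Λ.F k).obj (Γ.obj k) ⟶ (Ω.F k).obj (Γ.obj k))
    (ξ : Δ.obj k ⟶ (Λ.F k).obj (Γ.obj k)) : phi k γ (Λ.ι k ξ) = Ω.ι k (ξ ≫ γ) :=
  (exists_phi k γ).choose_spec 0 ξ

/-- Turns the C*-norm bound of a BQFS into a uniform operator bound. It is checked on levels `m ≥
k`, where `Φ_γ` is composition with `push γ`. -/
theorem norm_phi_le (k : ℕ) (γ : (Λ.F k).obj (Γ.obj k) ⟶ (Ω.F k).obj (Γ.obj k)) (x : Λ.H) :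
    ‖phi k γ x‖ ≤ ‖γ‖ * ‖x‖ := by
  refine HilbertTower.forall_of_level (S := Λ.tower) (p := fun x => ‖phi k γ x‖ ≤ ‖γ‖ * ‖x‖)
    (isClosed_le (by fun_prop) (by fun_prop)) k (fun m hm ξ => ?_) x
  obtain ⟨l, rfl⟩ := Nat.exists_eq_add_of_le hm
  refine (congrArg norm ((exists_phi k γ).choose_spec l ξ)).le.trans ?_
  refine (Λ.norm_ι_comp_le (k + l) ξ (push γ l)).trans ?_
  exact mul_le_mul_of_nonneg_right (norm_push_le γ l) (norm_nonneg _)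

end OneCell

/-! ### Loop operators as compressions -/

section LoopOperators

variable {Γ : ZeroCell.{v₁, u₁}} {Δ : ZeroCell.{v₂, u₂}} (R : Solutions Δ) {Λ Ω Ξ : OneCell Γ Δ}

theorem loop_app (k : ℕ) (φ : NT Λ Ω (k + 1)) (X : Γ.M k) :
    (loop R Λ Ω k φ).app X = (R k).partialTr
      ((Λ.W k).app X ≫ φ.app ((Γ.Γ k).obj X) ≫ dag ((Ω.W k).app X)) := rfl

theorem norm_loop_app_le (k : ℕ) (φ : NT Λ Ω (k + 1)) (X : Γ.M k) :
    ‖(loop R Λ Ω k φ).app X‖ ≤ ‖φ.app ((Γ.Γ k).obj X)‖ := by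
  rw [loop_app]
  refine ((R k).norm_partialTr_le (Δ.μ_pos k) (Δ.μ_compat k) _).trans ?_
  have h₁ := norm_le_one_of_isometry _ (Λ.W_dag k X)
  have h₂ := norm_le_one_of_isometry (dag ((Ω.W k).app X)) (by rw [dag_dag]; exact Ω.dag_W k X)
  refine (norm_comp_le _ _).trans ?_
  refine (mul_le_mul h₁ (norm_comp_le _ _) (norm_nonneg _) zero_le_one).trans ?_
  rw [one_mul]
  exact mul_le_of_le_one_right (norm_nonneg _) h₂

theorem norm_loopIter_app_le {c : ℝ} (k : ℕ) : ∀ (l : ℕ) (φ : NT Λ Ω (k + l)),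
    (∀ X, ‖φ.app X‖ ≤ c) → ∀ X, ‖(loopIter R Λ Ω k l φ).app X‖ ≤ c
  | 0, _, h => h
  | l + 1, φ, h => norm_loopIter_app_le k l _ fun X =>
      (norm_loop_app_le R (k + l) φ X).trans (h _)

/-- By the bimodule property of `partialTr`, the left side is the trace of a partial trace, hence a
trace one level up. There the unitaries `W` in `S` are exactly those that include `ξ` and `ζ` in
level `k + 1`. So `Φ_{Sφ}` is the compression of `Φ_φ` to level `k`. -/
theorem inner_phi_loop (k : ℕ) (φ : NT Λ Ω (k + 1))
    (ξ : Δ.obj k ⟶ (Λ.F k).obj (Γ.obj k)) (ζ : Δ.obj k ⟶ (Ω.F k).obj (Γ.obj k)) :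
    inner ℂ (Ω.ι k ζ) (OneCell.phi k ((loop R Λ Ω k φ).app (Γ.obj k)) (Λ.ι k ξ)) =
      inner ℂ (Ω.ι k ζ) (OneCell.phi (k + 1) (φ.app (Γ.obj (k + 1))) (Λ.ι k ξ)) := by
  rw [OneCell.phi_ι, OneCell.inner_ι, ← Λ.ι_incl, ← Ω.ι_incl, OneCell.phi_ι, OneCell.inner_ι,
    loop_app, ← (R k).map_comp_partialTr, ← (R k).partialTr_comp_map,
    (R k).catTr_partialTr (Δ.μ_pos k)]
  change catTr _ ((Δ.Γ k).obj (Δ.obj k)) _ = catTr _ ((Δ.Γ k).obj (Δ.obj k)) _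
  congr 1
  refine Eq.trans ?_ (congrArg (_ ≫ ·)
    (dag_comp ((Δ.Γ k).map ζ) ((Ω.W k).app (Γ.obj k))).symm)
  rw [StarFunctor.map_dag]
  -- Stated for abstract objects, since the actual ones match only after unfolding `obj (k + 1)` and
  -- functor composites.
  have assoc : ∀ {A₁ A₂ A₃ A₄ A₅ A₆ : Δ.M (k + 1)} (a : A₁ ⟶ A₂) (b : A₂ ⟶ A₃) (c : A₃ ⟶ A₄)
      (d : A₄ ⟶ A₅) (e : A₅ ⟶ A₆), (a ≫ b ≫ c ≫ d) ≫ e = ((a ≫ b) ≫ c) ≫ d ≫ e := by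
    intros
    simp only [Category.assoc]
  exact assoc _ _ _ _ _

theorem inner_phi_loopIter (k : ℕ) : ∀ (l : ℕ) (φ : NT Λ Ω (k + l))
    (ξ : Δ.obj k ⟶ (Λ.F k).obj (Γ.obj k)) (ζ : Δ.obj k ⟶ (Ω.F k).obj (Γ.obj k)),
    inner ℂ (Ω.ι k ζ) (OneCell.phi k ((loopIter R Λ Ω k l φ).app (Γ.obj k)) (Λ.ι k ξ)) =
      inner ℂ (Ω.ι k ζ) (OneCell.phi (k + l) (φ.app (Γ.obj (k + l))) (Λ.ι k ξ))
  | 0, _, _, _ => rfl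
  | l + 1, φ, ξ, ζ => by
    rw [loopIter, inner_phi_loopIter]
    -- The one-step identity is applied at level `k + l`, so both vectors are first represented
    -- there.
    obtain ⟨ξ', hξ⟩ := Λ.exists_ι_of_le (Nat.le_add_right k l) ξ
    obtain ⟨ζ', hζ⟩ := Ω.exists_ι_of_le (Nat.le_add_right k l) ζ
    rw [← hξ, ← hζ]
    exact inner_phi_loop R (k + l) φ ξ' ζ'

theorem phi_comp (k : ℕ) (φ : NT Λ Ω k) (χ : NT Ω Ξ k) {m : ℕ} (h : m ≤ k)
    (ξ : Δ.obj m ⟶ (Λ.F m).obj (Γ.obj m)) :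
    OneCell.phi k ((φ ≫ χ).app (Γ.obj k)) (Λ.ι m ξ) =
      OneCell.phi k (χ.app (Γ.obj k)) (OneCell.phi k (φ.app (Γ.obj k)) (Λ.ι m ξ)) := by
  obtain ⟨ξ', hξ⟩ := Λ.exists_ι_of_le h ξ
  rw [← hξ, OneCell.phi_ι, OneCell.phi_ι, OneCell.phi_ι, NatTrans.comp_app, Category.assoc]

end LoopOperators

/-! ### Martingale convergence and the operator `PB(η)` -/

namespace BQFS

variable {Γ : ZeroCell.{v₁, u₁}} {Δ : ZeroCell.{v₂, u₂}} {R : Solutions Δ} {Λ Ω : OneCell Γ Δ}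
  (η : BQFS R Λ Ω)

/-- The operator `Φ_{η^(k)}`. -/
def op (k : ℕ) : Λ.H →L[ℂ] Ω.H := OneCell.phi k ((η.seq k).app (Γ.obj k))

theorem exists_norm_op_le : ∃ c : ℝ, 0 ≤ c ∧ ∀ k x, ‖η.op k x‖ ≤ c * ‖x‖ := by
  obtain ⟨c, hc⟩ := η.bounded
  refine ⟨max c 0, le_max_right _ _, fun k x => (OneCell.norm_phi_le k _ x).trans ?_⟩
  exact mul_le_mul_of_nonneg_right ((hc k _).trans (le_max_left _ _)) (norm_nonneg _)

theorem op_ι_mem {k m : ℕ} (h : k ≤ m) (ξ : Δ.obj k ⟶ (Λ.F k).obj (Γ.obj k)) :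
    ∃ ζ, Ω.ι m ζ = η.op m (Λ.ι k ξ) := by
  obtain ⟨ξ', hξ⟩ := Λ.exists_ι_of_le h ξ
  exact ⟨_, by rw [← hξ, op, OneCell.phi_ι]⟩

/-- The martingale property of `k ↦ Φ_{η^(k)}`. -/
theorem inner_op {k m : ℕ} (h : k ≤ m) (ξ : Δ.obj k ⟶ (Λ.F k).obj (Γ.obj k))
    (ζ : Δ.obj k ⟶ (Ω.F k).obj (Γ.obj k)) :
    inner ℂ (Ω.ι k ζ) (η.op m (Λ.ι k ξ)) = inner ℂ (Ω.ι k ζ) (η.op k (Λ.ι k ξ)) := by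
  induction m, h using Nat.le_induction with
  | base => rfl
  | succ m h ih =>
    rw [← ih]
    obtain ⟨ξ', hξ⟩ := Λ.exists_ι_of_le h ξ
    obtain ⟨ζ', hζ⟩ := Ω.exists_ι_of_le h ζ
    rw [← hξ, ← hζ, op, op, ← inner_phi_loop R, η.quasiFlat]

/-- Pythagoras: `η.op m (Λ.ι k ξ)` lies in level `m`, and by `inner_op` the increment from `m` to
`n` is orthogonal to level `m`. -/
theorem norm_op_sub_sq {k m n : ℕ} (h : k ≤ m) (h' : m ≤ n)
    (ξ : Δ.obj k ⟶ (Λ.F k).obj (Γ.obj k)) :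
    ‖η.op n (Λ.ι k ξ) - η.op m (Λ.ι k ξ)‖ ^ 2 =
      ‖η.op n (Λ.ι k ξ)‖ ^ 2 - ‖η.op m (Λ.ι k ξ)‖ ^ 2 := by
  obtain ⟨ξ', hξ⟩ := Λ.exists_ι_of_le h ξ
  obtain ⟨ζ, hζ⟩ := η.op_ι_mem h ξ
  have h₁ : inner ℂ (η.op m (Λ.ι k ξ)) (η.op n (Λ.ι k ξ)) =
      inner ℂ (η.op m (Λ.ι k ξ)) (η.op m (Λ.ι k ξ)) := by
    have := η.inner_op h' ξ' ζ
    rwa [hξ, hζ] at this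
  rw [@norm_sub_sq ℂ, ← inner_conj_symm, h₁, inner_self_conj, ← norm_sq_eq_re_inner]
  ring

/-- The squared norms are monotone and bounded, hence Cauchy, and by `norm_op_sub_sq` their
differences are the squared distances. -/
theorem cauchySeq_op_ι (k : ℕ) (ξ : Δ.obj k ⟶ (Λ.F k).obj (Γ.obj k)) :
    CauchySeq fun m => η.op m (Λ.ι k ξ) := by
  obtain ⟨c, hc, hb⟩ := η.exists_norm_op_le
  let a : ℕ → ℝ := fun m => ‖η.op (k + m) (Λ.ι k ξ)‖ ^ 2
  have ha : Monotone a := fun m n h => by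
    have := η.norm_op_sub_sq (Nat.le_add_right k m) (Nat.add_le_add_left h k) ξ
    have := sq_nonneg ‖η.op (k + n) (Λ.ι k ξ) - η.op (k + m) (Λ.ι k ξ)‖
    simp only [a]
    linarith
  have hbd : BddAbove (Set.range a) := by
    refine ⟨(c * ‖Λ.ι k ξ‖) ^ 2, ?_⟩
    rintro _ ⟨m, rfl⟩
    exact pow_le_pow_left₀ (norm_nonneg _) (hb _ _) 2
  have hlim := tendsto_atTop_ciSup ha hbd
  rw [← cauchySeq_shift k, Metric.cauchySeq_iff']
  intro ε hε
  obtain ⟨N, hN⟩ := Metric.cauchySeq_iff'.1 hlim.cauchySeq (ε ^ 2) (by positivity)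
  refine ⟨N, fun n hn => ?_⟩
  have h₁ := hN n hn
  have h₂ := η.norm_op_sub_sq (Nat.le_add_right k N) (Nat.add_le_add_left hn k) ξ
  rw [Real.dist_eq] at h₁
  rw [dist_eq_norm, add_comm n k, add_comm N k]
  refine lt_of_pow_lt_pow_left₀ 2 hε.le ?_
  rw [h₂]
  exact (le_abs_self _).trans_lt h₁

theorem cauchySeq_op (x : Λ.H) : CauchySeq fun m => η.op m x := by
  obtain ⟨c, hc, hb⟩ := η.exists_norm_op_le
  rw [Metric.cauchySeq_iff']
  intro ε hε
  -- Chosen so that every operator, of norm at most `c`, moves the error by at most `ε / 3`. Using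
  -- `c + 1` avoids dividing by zero.
  obtain ⟨y, ⟨k, ξ, rfl⟩, hy⟩ := Λ.tower.dense_level.exists_dist_lt x
    (ε := ε / (3 * (c + 1))) (by positivity)
  obtain ⟨N, hN⟩ := Metric.cauchySeq_iff'.1 (η.cauchySeq_op_ι k ξ) (ε / 3) (by positivity)
  refine ⟨N, fun n hn => ?_⟩
  have h₁ := hN n hn
  have h₂ : ∀ m, dist (η.op m x) (η.op m (Λ.ι k ξ)) ≤ ε / 3 := by
    intro m
    rw [dist_eq_norm, ← map_sub]
    refine (hb m _).trans ?_
    rw [dist_eq_norm] at hy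
    have hy' : ‖x - Λ.ι k ξ‖ ≤ ε / (3 * (c + 1)) := hy.le
    calc c * ‖x - Λ.ι k ξ‖ ≤ (c + 1) * (ε / (3 * (c + 1))) := by gcongr; linarith
      _ = ε / 3 := by field_simp
  have h₃ := dist_triangle4 (η.op n x) (η.op n (Λ.ι k ξ)) (η.op N (Λ.ι k ξ)) (η.op N x)
  have h₄ := h₂ n
  have h₅ := h₂ N
  rw [dist_comm] at h₅
  linarith

/-- The pointwise limit of a sequence of bounded operators on a Banach space is bounded, by
Banach–Steinhaus. -/
theorem exists_isLimit : ∃ T, η.IsLimit T := by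
  choose f hf using fun x => cauchySeq_tendsto_of_complete (η.cauchySeq_op x)
  exact ⟨continuousLinearMapOfTendsto (fun m => η.op m) (tendsto_pi_nhds.2 hf), hf⟩

theorem isLimit_PB : η.IsLimit η.PB := by
  rw [PB, dif_pos η.exists_isLimit]
  exact η.exists_isLimit.choose_spec

/-- By `inner_op` the scalar products converging to the left side are constant from `k` on. -/
theorem inner_PB (k : ℕ) (ξ : Δ.obj k ⟶ (Λ.F k).obj (Γ.obj k))
    (ζ : Δ.obj k ⟶ (Ω.F k).obj (Γ.obj k)) :
    inner ℂ (Ω.ι k ζ) (η.PB (Λ.ι k ξ)) = inner ℂ (Ω.ι k ζ) (η.op k (Λ.ι k ξ)) := by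
  have h : Filter.Tendsto (fun m => inner ℂ (Ω.ι k ζ) (η.op m (Λ.ι k ξ))) Filter.atTop
      (nhds (inner ℂ (Ω.ι k ζ) (η.PB (Λ.ι k ξ)))) :=
    tendsto_const_nhds.inner (η.isLimit_PB (Λ.ι k ξ))
  refine tendsto_nhds_unique h (tendsto_const_nhds.congr' ?_)
  filter_upwards [Filter.eventually_ge_atTop k] with m hm
  exact (η.inner_op hm ξ ζ).symm

end BQFS

/-! ### The algebra `A_∞` and normal functionals on its bicommutant -/

namespace ZeroCell

variable (Γ : ZeroCell.{v, u})

/-- The image in `A_m` of `α ∈ A_k`, for `k ≤ m`. -/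
def up {k m : ℕ} (h : k ≤ m) (α : Γ.obj k ⟶ Γ.obj k) : Γ.obj m ⟶ Γ.obj m :=
  Γ.tower.trans k m h α

theorem up_self {k : ℕ} (α : Γ.obj k ⟶ Γ.obj k) : Γ.up le_rfl α = α :=
  Γ.tower.trans_self k α

theorem up_succ {k m : ℕ} (h : k ≤ m) (α : Γ.obj k ⟶ Γ.obj k) :
    Γ.up (h.trans (Nat.le_succ m)) α = (Γ.Γ m).map (Γ.up h α) :=
  Γ.tower.trans_succ k m h α

theorem up_up {k m n : ℕ} (h : k ≤ m) (h' : m ≤ n) (α : Γ.obj k ⟶ Γ.obj k) :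
    Γ.up h' (Γ.up h α) = Γ.up (h.trans h') α :=
  Γ.tower.trans_trans k m n h h' α

/-- Replaces the index `k + l` by an inequality, so that elements of different levels can be moved
to a common one without casts. -/
theorem lift_eq_up {k : ℕ} (α : Γ.obj k ⟶ Γ.obj k) (l : ℕ) :
    Γ.lift α l = Γ.up (Nat.le_add_right k l) α := by
  induction l with
  | zero => exact (Γ.up_self α).symm
  | succ l ih => exact (congrArg (Γ.Γ (k + l)).map ih).trans (Γ.up_succ _ α).symm

theorem up_add {k m : ℕ} (h : k ≤ m) (α β : Γ.obj k ⟶ Γ.obj k) :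
    Γ.up h (α + β) = Γ.up h α + Γ.up h β :=
  map_add (Γ.tower.trans k m h) α β

theorem up_smul {k m : ℕ} (h : k ≤ m) (r : ℂ) (α : Γ.obj k ⟶ Γ.obj k) :
    Γ.up h (r • α) = r • Γ.up h α :=
  map_smul (Γ.tower.trans k m h) r α

theorem up_comp {k m : ℕ} (h : k ≤ m) (α β : Γ.obj k ⟶ Γ.obj k) :
    Γ.up h (α ≫ β) = Γ.up h α ≫ Γ.up h β := by
  induction m, h using Nat.le_induction with
  | base => simp only [up_self]
  | succ m h ih =>
    rw [up_succ Γ h, up_succ Γ h, up_succ Γ h, ih]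
    exact Functor.map_comp _ _ _

theorem up_dag {k m : ℕ} (h : k ≤ m) (α : Γ.obj k ⟶ Γ.obj k) :
    Γ.up h (dag α) = dag (Γ.up h α) := by
  induction m, h using Nat.le_induction with
  | base => simp only [up_self]
  | succ m h ih =>
    rw [up_succ Γ h, up_succ Γ h, ih]
    exact StarFunctor.map_dag _ _

theorem up_id {k m : ℕ} (h : k ≤ m) : Γ.up h (𝟙 (Γ.obj k)) = 𝟙 (Γ.obj m) := by
  induction m, h using Nat.le_induction with
  | base => simp only [up_self]
  | succ m h ih =>
    rw [up_succ Γ h, ih]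
    exact CategoryTheory.Functor.map_id _ _

/-- The canonical map `A_k → L²(A_∞)`. -/
def ι (k : ℕ) (x : Γ.obj k ⟶ Γ.obj k) : Γ.L2 := Γ.tower.ι k x

theorem ι_up {k m : ℕ} (h : k ≤ m) (x : Γ.obj k ⟶ Γ.obj k) : Γ.ι m (Γ.up h x) = Γ.ι k x :=
  Γ.tower.ι_trans k m h x

theorem inner_ι (k : ℕ) (x y : Γ.obj k ⟶ Γ.obj k) :
    inner ℂ (Γ.ι k x) (Γ.ι k y) = catTr (Γ.μ k) _ (y ≫ dag x) :=
  Γ.tower.inner_ι k x y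

theorem ι_add (k : ℕ) (x y : Γ.obj k ⟶ Γ.obj k) : Γ.ι k (x + y) = Γ.ι k x + Γ.ι k y :=
  map_add (Γ.tower.ι k) x y

theorem ι_smul (k : ℕ) (r : ℂ) (x : Γ.obj k ⟶ Γ.obj k) : Γ.ι k (r • x) = r • Γ.ι k x :=
  map_smul (Γ.tower.ι k) r x

theorem leftMul_ι {k m : ℕ} (h : k ≤ m) (α : Γ.obj k ⟶ Γ.obj k) (x : Γ.obj m ⟶ Γ.obj m) :
    Γ.leftMul k α (Γ.ι m x) = Γ.ι m (x ≫ Γ.up h α) := by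
  obtain ⟨l, rfl⟩ := Nat.exists_eq_add_of_le h
  rw [← lift_eq_up]
  exact (Γ.exists_leftMul k α).choose_spec l x

theorem eq_leftMul {k : ℕ} (α : Γ.obj k ⟶ Γ.obj k) (T : Γ.L2 →L[ℂ] Γ.L2)
    (h : ∀ m (hm : k ≤ m) (x : Γ.obj m ⟶ Γ.obj m),
      T (Γ.ι m x) = Γ.ι m (x ≫ Γ.up hm α)) :
    T = Γ.leftMul k α :=
  DFunLike.coe_injective (HilbertTower.eq_of_forall_level (S := Γ.tower) T.continuous
    (Γ.leftMul k α).continuous k fun m hm x => (h m hm x).trans (Γ.leftMul_ι hm α x).symm)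

theorem leftMul_up {k m : ℕ} (h : k ≤ m) (α : Γ.obj k ⟶ Γ.obj k) :
    Γ.leftMul k α = Γ.leftMul m (Γ.up h α) :=
  Γ.eq_leftMul _ _ fun n hn x => by rw [leftMul_ι _ (h.trans hn), up_up]

theorem leftMul_add {k : ℕ} (α β : Γ.obj k ⟶ Γ.obj k) :
    Γ.leftMul k α + Γ.leftMul k β = Γ.leftMul k (α + β) :=
  Γ.eq_leftMul _ _ fun n hn x => by
    rw [add_apply, leftMul_ι _ hn, leftMul_ι _ hn, up_add, ← ι_add,
      Preadditive.comp_add]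

theorem leftMul_smul {k : ℕ} (r : ℂ) (α : Γ.obj k ⟶ Γ.obj k) :
    r • Γ.leftMul k α = Γ.leftMul k (r • α) :=
  Γ.eq_leftMul _ _ fun n hn x => by
    rw [smul_apply, leftMul_ι _ hn, up_smul, ← ι_smul, Linear.comp_smul]

theorem leftMul_mul {k : ℕ} (α β : Γ.obj k ⟶ Γ.obj k) :
    Γ.leftMul k α * Γ.leftMul k β = Γ.leftMul k (β ≫ α) :=
  Γ.eq_leftMul _ _ fun n hn x => by
    rw [mul_apply_eq_comp, leftMul_ι _ hn, leftMul_ι _ hn, up_comp, Category.assoc]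

theorem leftMul_id (k : ℕ) : 1 = Γ.leftMul k (𝟙 (Γ.obj k)) :=
  Γ.eq_leftMul _ _ fun n hn x => by
    rw [up_id, Category.comp_id]
    rfl

/-- Moved to a common level, `⟨α z, x⟩` and `⟨z, α† x⟩` are the trace of the same composite. -/
theorem star_leftMul {k : ℕ} (α : Γ.obj k ⟶ Γ.obj k) :
    star (Γ.leftMul k α) = Γ.leftMul k (dag α) :=
  Γ.eq_leftMul _ _ fun n hn x => by
    refine HilbertTower.eq_of_inner_level (S := Γ.tower) n fun m hm
      (z : Γ.obj m ⟶ Γ.obj m) => ?_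
    change inner ℂ (Γ.ι m z) _ = inner ℂ (Γ.ι m z) _
    rw [ContinuousLinearMap.star_eq_adjoint, ContinuousLinearMap.adjoint_inner_right,
      ← Γ.ι_up hm, ← Γ.ι_up hm, leftMul_ι _ (hn.trans hm), inner_ι, inner_ι, up_comp, up_up,
      up_dag, dag_comp, Category.assoc]

/-- The `*`-algebra `A_∞ = ⋃ A_k` of left multiplication operators. -/
def leftAlg : StarSubalgebra ℂ (Γ.L2 →L[ℂ] Γ.L2) where
  carrier := {t | ∃ k α, t = Γ.leftMul k α}
  mul_mem' := by
    rintro _ _ ⟨k, α, rfl⟩ ⟨l, β, rfl⟩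
    exact ⟨max k l, _, by rw [Γ.leftMul_up (le_max_left k l), Γ.leftMul_up (le_max_right k l),
      leftMul_mul]⟩
  one_mem' := ⟨0, _, Γ.leftMul_id 0⟩
  add_mem' := by
    rintro _ _ ⟨k, α, rfl⟩ ⟨l, β, rfl⟩
    exact ⟨max k l, _, by rw [Γ.leftMul_up (le_max_left k l), Γ.leftMul_up (le_max_right k l),
      leftMul_add]⟩
  zero_mem' := ⟨0, 0, by
    have := Γ.leftMul_smul (0 : ℂ) (0 : Γ.obj 0 ⟶ Γ.obj 0)
    rwa [zero_smul, zero_smul] at this⟩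
  algebraMap_mem' r := ⟨0, r • 𝟙 (Γ.obj 0), by
    rw [← leftMul_smul, ← leftMul_id, Algebra.algebraMap_eq_smul_one]⟩
  star_mem' := by
    rintro _ ⟨k, α, rfl⟩
    exact ⟨k, dag α, Γ.star_leftMul α⟩

theorem leftMul_mem_PB (k : ℕ) (α : Γ.obj k ⟶ Γ.obj k) :
    Γ.leftMul k α ∈ Γ.PB.toStarSubalgebra := by
  refine (StarSubalgebra.mem_centralizer_iff ℂ).2 fun g hg => ?_
  have h := (StarSubalgebra.mem_centralizer_iff ℂ).1 hg
  have h₁ := h _ ⟨k, α, rfl⟩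
  have h₂ := h _ ⟨k, dag α, rfl⟩
  refine ⟨h₁.1.symm, ?_⟩
  -- Commuting with `star g` is the adjoint of the relation between `g` and the star of the
  -- multiplication operator.
  have := congrArg star h₁.2
  rw [star_mul, star_mul, star_star] at this
  exact this

/-- If two vector functionals of normal maps on `A` agree on `A_∞`, then they agree on `A`. -/
theorem inner_eq_of_isNormalMap {H₁ H₂ : Type*} [NormedAddCommGroup H₁] [InnerProductSpace ℂ H₁]
    [NormedAddCommGroup H₂] [InnerProductSpace ℂ H₂]
    {π₁ : Γ.PB.toStarSubalgebra → (H₁ →L[ℂ] H₁)} {π₂ : Γ.PB.toStarSubalgebra → (H₂ →L[ℂ] H₂)}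
    (h₁ : IsNormalMap Γ.PB π₁) (h₂ : IsNormalMap Γ.PB π₂) {ξ₁ ζ₁ : H₁} {ξ₂ ζ₂ : H₂}
    (h : ∀ (k : ℕ) (α : Γ.obj k ⟶ Γ.obj k),
      inner ℂ ζ₁ (π₁ ⟨Γ.leftMul k α, Γ.leftMul_mem_PB k α⟩ ξ₁) =
        inner ℂ ζ₂ (π₂ ⟨Γ.leftMul k α, Γ.leftMul_mem_PB k α⟩ ξ₂))
    (a : Γ.PB.toStarSubalgebra) : inner ℂ ζ₁ (π₁ a ξ₁) = inner ℂ ζ₂ (π₂ a ξ₂) := by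
  obtain ⟨x₁, y₁, hx₁, hy₁, e₁⟩ := h₁ ξ₁ ζ₁
  obtain ⟨x₂, y₂, hx₂, hy₂, e₂⟩ := h₂ ξ₂ ζ₂
  -- The difference of the two functionals is again of the form `∑ ⟨y_i, a x_i⟩`, over the disjoint
  -- union of the index sets with a sign on `y₂`. It vanishes on `leftAlg`, whose bicommutant is
  -- `PB`.
  have key : ∀ a : Γ.PB.toStarSubalgebra, HasSum (fun i : ℕ ⊕ ℕ =>
      inner ℂ (Sum.elim y₁ (-y₂) i) ((a : Γ.L2 →L[ℂ] Γ.L2) (Sum.elim x₁ x₂ i)))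
      (inner ℂ ζ₁ (π₁ a ξ₁) - inner ℂ ζ₂ (π₂ a ξ₂)) := by
    intro a
    rw [sub_eq_add_neg, ← inner_neg_left]
    refine HasSum.sum (e₁ a) ?_
    have h := (e₂ a).neg
    simp only [← inner_neg_left] at h
    exact h
  have hx : Summable fun i => ‖Sum.elim x₁ x₂ i‖ ^ 2 :=
    (HasSum.sum (f := fun i => ‖Sum.elim x₁ x₂ i‖ ^ 2) hx₁.hasSum hx₂.hasSum).summable
  have hy : Summable fun i => ‖Sum.elim y₁ (-y₂) i‖ ^ 2 := by
    refine (HasSum.sum (f := fun i => ‖Sum.elim y₁ (-y₂) i‖ ^ 2) hy₁.hasSum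
      (b := ∑' i, ‖y₂ i‖ ^ 2) ?_).summable
    convert hy₂.hasSum using 2
    simp only [Function.comp_apply, Sum.elim_inr, Pi.neg_apply, norm_neg]
  refine sub_eq_zero.1 ((key a).tsum_eq.symm.trans
    (tsum_inner_eq_zero_of_bicommutant Γ.leftAlg hx hy ?_ a.2))
  rintro _ ⟨k, α, rfl⟩
  exact (key ⟨_, Γ.leftMul_mem_PB k α⟩).tsum_eq.trans (sub_eq_zero.2 (h k α))

end ZeroCell

/-! ### The bimodule property of the limits -/

section Bimodules

variable {Γ : ZeroCell.{v₁, u₁}} {Δ : ZeroCell.{v₂, u₂}} {R : Solutions Δ} {Λ Ω : OneCell Γ Δ}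

theorem OneCell.left_ι {k m : ℕ} (h : k ≤ m) (α : Γ.obj k ⟶ Γ.obj k)
    (ξ : Δ.obj m ⟶ (Λ.F m).obj (Γ.obj m)) :
    Λ.left k α (Λ.ι m ξ) = Λ.ι m (ξ ≫ (Λ.F m).map (Γ.up h α)) := by
  obtain ⟨l, rfl⟩ := Nat.exists_eq_add_of_le h
  rw [← ZeroCell.lift_eq_up]
  exact (Λ.exists_left k α).choose_spec l ξ

theorem OneCell.right_ι {k m : ℕ} (h : k ≤ m) (β : Δ.obj k ⟶ Δ.obj k)
    (ξ : Δ.obj m ⟶ (Λ.F m).obj (Γ.obj m)) :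
    Λ.right k β (Λ.ι m ξ) = Λ.ι m (Δ.up h β ≫ ξ) := by
  obtain ⟨l, rfl⟩ := Nat.exists_eq_add_of_le h
  rw [← ZeroCell.lift_eq_up]
  exact (Λ.exists_right k β).choose_spec l ξ

/-- A bounded operator which commutes with the actions of `A_∞` and `B_∞` is a bimodule map. -/
theorem OneCell.isBimoduleMap_of_comm {T : Λ.H →L[ℂ] Ω.H}
    (hl : ∀ k α, T ∘L Λ.left k α = Ω.left k α ∘L T)
    (hr : ∀ k β, T ∘L Λ.right k β = Ω.right k β ∘L T) : IsBimoduleMap T where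
  left := hl
  right := hr
  left' π π' hπ hπ' a := by
    ext1 x
    refine ext_inner_left ℂ fun z => ?_
    -- Moving `T` to the other side as `T†` makes `⟨z, T π(a) x⟩` a vector functional of `π`. It
    -- agrees with `⟨z, π'(a) T x⟩` on `A_∞` by `hl`.
    have h := Γ.inner_eq_of_isNormalMap hπ.1 hπ'.1 (ξ₁ := x) (ζ₁ := T.adjoint z) (ξ₂ := T x)
      (ζ₂ := z) (fun k α => by
        rw [hπ.2 k α _ rfl, hπ'.2 k α _ rfl, ContinuousLinearMap.adjoint_inner_left]
        exact congrArg (fun S => inner ℂ z (S x)) (hl k α)) a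
    rwa [ContinuousLinearMap.adjoint_inner_left] at h
  right' π π' hπ hπ' b := by
    ext1 x
    refine ext_inner_left ℂ fun z => ?_
    have h := Δ.inner_eq_of_isNormalMap hπ.1 hπ'.1 (ξ₁ := x) (ζ₁ := T.adjoint z) (ξ₂ := T x)
      (ζ₂ := z) (fun k β => by
        rw [hπ.2 k β _ rfl, hπ'.2 k β _ rfl, ContinuousLinearMap.adjoint_inner_left]
        exact congrArg (fun S => inner ℂ z (S x)) (hr k β)) b.unop
    rwa [ContinuousLinearMap.adjoint_inner_left] at h

/-- A vector of level `m` lies in level `n` for all `n ≥ m`, so the relation for `η.op n` on level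
`n` alone survives in the limit. -/
theorem BQFS.comm_of_isLimit {η : BQFS R Λ Ω} {T : Λ.H →L[ℂ] Ω.H} (hT : η.IsLimit T)
    (a : Λ.H →L[ℂ] Λ.H) (b : Ω.H →L[ℂ] Ω.H) (k : ℕ)
    (h : ∀ n, k ≤ n → ∀ ξ, η.op n (a (Λ.ι n ξ)) = b (η.op n (Λ.ι n ξ))) :
    T ∘L a = b ∘L T := by
  refine DFunLike.coe_injective (HilbertTower.eq_of_forall_level (S := Λ.tower)
    (T ∘L a).continuous (b ∘L T).continuous k fun m hm ξ => ?_)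
  refine tendsto_nhds_unique (hT (a (Λ.ι m ξ)))
    (((b.continuous.tendsto _).comp (hT (Λ.ι m ξ))).congr' ?_)
  filter_upwards [Filter.eventually_ge_atTop m] with n hn
  obtain ⟨ξ', hξ⟩ := Λ.exists_ι_of_le hn ξ
  rw [← hξ]
  exact (h n (hm.trans hn) ξ').symm

theorem BQFS.isBimoduleMap_PB (η : BQFS R Λ Ω) : OneCell.IsBimoduleMap η.PB := by
  refine OneCell.isBimoduleMap_of_comm (fun k α => ?_) (fun k β => ?_)
  · refine comm_of_isLimit η.isLimit_PB _ _ k fun n hn ξ => ?_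
    rw [op, OneCell.left_ι hn, OneCell.phi_ι, OneCell.phi_ι, OneCell.left_ι hn, Category.assoc,
      (η.seq n).naturality, Category.assoc]
  · refine comm_of_isLimit η.isLimit_PB _ _ k fun n hn ξ => ?_
    rw [op, OneCell.right_ι hn, OneCell.phi_ι, OneCell.phi_ι, OneCell.right_ι hn, Category.assoc]

end Bimodules

/-! ### Matrix coefficients, norm convergence and the product of two sequences -/

section Coefficients

variable {Γ : ZeroCell.{v₁, u₁}} {Δ : ZeroCell.{v₂, u₂}} {R : Solutions Δ}
  {Λ Ω Ξ : OneCell Γ Δ} {k : ℕ}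

/-- The matrix coefficients of a natural transformation are scalar products in the bimodule. -/
theorem exists_coeff_eq_inner {v : V (Γ.M k)} {w : V (Δ.M k)}
    (σ : simple w ⟶ (Λ.F k).obj (simple v)) (τ : simple w ⟶ (Ω.F k).obj (simple v)) :
    ∃ ξ ζ, ∀ φ : NT Λ Ω k, scal (σ ≫ φ.app (simple v) ≫ dag τ) * Δ.μ k w =
      inner ℂ (Ω.ι k ζ) (OneCell.phi k (φ.app (Γ.obj k)) (Λ.ι k ξ)) := by
  obtain ⟨s, hs⟩ := Γ.exists_isometry k v
  obtain ⟨p, hp⟩ := Δ.exists_isometry k w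
  -- Naturality removes `s`, and cyclicity of the trace removes `p`, leaving a trace on the simple
  -- object `w`, whence the factor `μ k w`.
  refine ⟨dag p ≫ σ ≫ (Λ.F k).map s, dag p ≫ τ ≫ (Ω.F k).map s, fun φ => ?_⟩
  rw [OneCell.phi_ι, OneCell.inner_ι]
  have e : ((dag p ≫ σ ≫ (Λ.F k).map s) ≫ φ.app (Γ.obj k)) ≫
      dag (dag p ≫ τ ≫ (Ω.F k).map s) = dag p ≫ (σ ≫ φ.app (simple v) ≫ dag τ) ≫ p := by
    have h : (Λ.F k).map s ≫ φ.app (Γ.obj k) ≫ dag ((Ω.F k).map s) = φ.app (simple v) := by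
      rw [← StarFunctor.map_dag, ← φ.naturality, ← Category.assoc, ← Functor.map_comp, hs,
        CategoryTheory.Functor.map_id, Category.id_comp]
    rw [← h, dag_comp, dag_comp, dag_dag]
    simp only [Category.assoc]
  rw [e, catTr_comm, Category.assoc, hp, Category.comp_id, catTr_simple]

theorem NT_ext {φ χ : NT Λ Ω k}
    (h : ∀ ξ ζ, inner ℂ (Ω.ι k ζ) (OneCell.phi k (φ.app (Γ.obj k)) (Λ.ι k ξ)) =
      inner ℂ (Ω.ι k ζ) (OneCell.phi k (χ.app (Γ.obj k)) (Λ.ι k ξ))) : φ = χ := by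
  have hv : ∀ v : V (Γ.M k), φ.app (simple v) = χ.app (simple v) := by
    intro v
    rw [eq_sum_coeff (φ.app (simple v)), eq_sum_coeff (χ.app (simple v))]
    refine Finset.sum_congr rfl fun w _ => Finset.sum_congr rfl fun a _ =>
      Finset.sum_congr rfl fun b _ => ?_
    obtain ⟨ξ, ζ, hc⟩ := exists_coeff_eq_inner (onb ((Λ.F k).obj (simple v)) w a)
      (onb ((Ω.F k).obj (simple v)) w b)
    have h0 : (Δ.μ k w : ℂ) ≠ 0 := by exact_mod_cast (Δ.μ_pos k w).ne'
    rw [mul_right_cancel₀ h0 ((hc φ).trans ((h ξ ζ).trans (hc χ).symm))]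
  ext X
  rw [app_eq_blockDiag φ, app_eq_blockDiag χ]
  simp only [hv]

/-- Weak convergence gives convergence of the finitely many coefficients at `v`, which assemble to a
norm limit through `eq_sum_coeff`. -/
theorem cauchySeq_app_simple {θ : ℕ → NT Λ Ω k} {T : Λ.H →L[ℂ] Ω.H}
    (h : ∀ ξ ζ, Filter.Tendsto (fun l =>
      inner ℂ (Ω.ι k ζ) (OneCell.phi k ((θ l).app (Γ.obj k)) (Λ.ι k ξ))) Filter.atTop
      (nhds (inner ℂ (Ω.ι k ζ) (T (Λ.ι k ξ))))) (v : V (Γ.M k)) :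
    CauchySeq fun l => (θ l).app (simple v) := by
  have hc : ∀ w a b, ∃ c : ℂ, Filter.Tendsto (fun l => scal
      (onb ((Λ.F k).obj (simple v)) w a ≫ (θ l).app (simple v) ≫
        dag (onb ((Ω.F k).obj (simple v)) w b))) Filter.atTop (nhds c) := by
    intro w a b
    obtain ⟨ξ, ζ, hc⟩ := exists_coeff_eq_inner (onb ((Λ.F k).obj (simple v)) w a)
      (onb ((Ω.F k).obj (simple v)) w b)
    have h0 : (Δ.μ k w : ℂ) ≠ 0 := by exact_mod_cast (Δ.μ_pos k w).ne'
    refine ⟨_, ((h ξ ζ).div_const (Δ.μ k w : ℂ)).congr fun l => ?_⟩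
    rw [← hc, mul_div_cancel_right₀ _ h0]
  choose c hc using hc
  have := tendsto_finsetSum (Finset.univ : Finset (V (Δ.M k))) fun w _ =>
    tendsto_finsetSum Finset.univ fun a _ => tendsto_finsetSum Finset.univ fun b _ =>
      (hc w a b).smul_const (dag (onb ((Λ.F k).obj (simple v)) w a) ≫
        onb ((Ω.F k).obj (simple v)) w b)
  refine Filter.Tendsto.cauchySeq (this.congr fun l => ?_)
  exact (eq_sum_coeff ((θ l).app (simple v))).symm

/-- There are finitely many simple objects, and by `norm_app_le` they control all `X` at once, so
the Cauchy condition is uniform in `X`. -/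
theorem exists_NTTendsto {θ : ℕ → NT Λ Ω k}
    (h : ∀ v : V (Γ.M k), CauchySeq fun l => (θ l).app (simple v)) :
    ∃ ψ : NT Λ Ω k, NTTendsto θ ψ := by
  have hu : ∀ ε : ℝ, 0 < ε → ∃ N, ∀ l, N ≤ l → ∀ m, N ≤ m → ∀ X,
      ‖(θ l).app X - (θ m).app X‖ ≤ ε := by
    intro ε hε
    choose N hN using fun v => Metric.cauchySeq_iff.1 (h v) ε hε
    refine ⟨∑ v, N v, fun l hl m hm X => ?_⟩
    refine norm_app_le (F := Λ.F k) (G := Ω.F k) (θ l - θ m) hε.le (fun v => ?_) X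
    have hle : N v ≤ ∑ v, N v :=
      Finset.single_le_sum (fun _ _ => Nat.zero_le _) (Finset.mem_univ v)
    have := hN v l (hle.trans hl) m (hle.trans hm)
    rw [dist_eq_norm] at this
    exact this.le
  have hX : ∀ X, ∃ f, Filter.Tendsto (fun l => (θ l).app X) Filter.atTop (nhds f) := by
    intro X
    refine cauchySeq_tendsto_of_complete (Metric.cauchySeq_iff.2 fun ε hε => ?_)
    obtain ⟨N, hN⟩ := hu (ε / 2) (by positivity)
    refine ⟨N, fun l hl m hm => ?_⟩
    rw [dist_eq_norm]
    exact (hN l hl m hm X).trans_lt (by linarith)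
  choose f hf using hX
  -- Continuity of composition lets naturality pass to the limit.
  have hcl : ∀ {X Y Z : Δ.M k} (g : X ⟶ Y), Continuous fun t : Y ⟶ Z => g ≫ t := by
    intro X Y Z g
    exact (LinearMap.mkContinuous (Linear.leftComp ℂ Z g) ‖g‖ fun t => norm_comp_le g t).continuous
  have hcr : ∀ {X Y Z : Δ.M k} (g : Y ⟶ Z), Continuous fun t : X ⟶ Y => t ≫ g := by
    intro X Y Z g
    exact (LinearMap.mkContinuous (Linear.rightComp ℂ X g) ‖g‖ fun t =>
      (norm_comp_le t g).trans (mul_comm _ _).le).continuous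
  refine ⟨⟨f, fun X Y g => ?_⟩, fun ε hε => ?_⟩
  · refine tendsto_nhds_unique (((hcl _).tendsto _).comp (hf Y))
      ((((hcr _).tendsto _).comp (hf X)).congr fun l => ?_)
    exact ((θ l).naturality g).symm
  · obtain ⟨N, hN⟩ := hu ε hε
    refine ⟨N, fun l hl X => ?_⟩
    refine le_of_tendsto (tendsto_const_nhds.sub (hf X)).norm ?_
    filter_upwards [Filter.eventually_ge_atTop N] with m hm
    exact hN l hl m hm X

theorem NTTendsto.tendsto_app {θ : ℕ → NT Λ Ω k} {ψ : NT Λ Ω k} (h : NTTendsto θ ψ)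
    (X : Γ.M k) : Filter.Tendsto (fun l => (θ l).app X) Filter.atTop (nhds (ψ.app X)) := by
  refine Metric.tendsto_atTop.2 fun ε hε => ?_
  obtain ⟨N, hN⟩ := h (ε / 2) (by positivity)
  refine ⟨N, fun l hl => ?_⟩
  rw [dist_eq_norm]
  exact (hN l hl X).trans_lt (by linarith)

theorem NTTendsto.tendsto_phi {θ : ℕ → NT Λ Ω k} {ψ : NT Λ Ω k} (h : NTTendsto θ ψ)
    (ξ : Δ.obj k ⟶ (Λ.F k).obj (Γ.obj k)) :
    Filter.Tendsto (fun l => OneCell.phi k ((θ l).app (Γ.obj k)) (Λ.ι k ξ)) Filter.atTop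
      (nhds (OneCell.phi k (ψ.app (Γ.obj k)) (Λ.ι k ξ))) := by
  have h0 := (tendsto_iff_norm_sub_tendsto_zero.1 (h.tendsto_app (Γ.obj k))).mul_const ‖Λ.ι k ξ‖
  rw [zero_mul] at h0
  refine tendsto_iff_norm_sub_tendsto_zero.2 (squeeze_zero (fun _ => norm_nonneg _) (fun l => ?_) h0)
  have e : Ω.ι k (ξ ≫ ((θ l).app (Γ.obj k) - ψ.app (Γ.obj k))) =
      Ω.ι k (ξ ≫ (θ l).app (Γ.obj k)) - Ω.ι k (ξ ≫ ψ.app (Γ.obj k)) := by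
    rw [Preadditive.comp_sub]
    exact map_sub (Ω.tower.ι k) _ _
  rw [OneCell.phi_ι, OneCell.phi_ι, ← e]
  exact Λ.norm_ι_comp_le k ξ _

/-- Split `κ_m η_m x = κ_m (η_m x - η x) + κ_m η x`; the uniform bound on `κ_m` kills the first
term. -/
theorem BQFS.tendsto_op_op (η : BQFS R Λ Ω) (κ : BQFS R Ω Ξ) (x : Λ.H) :
    Filter.Tendsto (fun m => κ.op m (η.op m x)) Filter.atTop (nhds (κ.PB (η.PB x))) := by
  obtain ⟨c, -, hb⟩ := κ.exists_norm_op_le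
  have h₁ : Filter.Tendsto (fun m => κ.op m (η.PB x)) Filter.atTop (nhds (κ.PB (η.PB x))) :=
    κ.isLimit_PB _
  have h₂ : Filter.Tendsto (fun m => η.op m x) Filter.atTop (nhds (η.PB x)) := η.isLimit_PB x
  have h₃ := (tendsto_iff_norm_sub_tendsto_zero.1 h₂).const_mul c
  rw [mul_zero] at h₃
  have h₄ : Filter.Tendsto (fun m => κ.op m (η.op m x - η.PB x)) Filter.atTop (nhds 0) :=
    squeeze_zero_norm (fun m => hb m _) h₃
  have h₅ := h₄.add h₁
  rw [zero_add] at h₅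
  refine h₅.congr fun m => ?_
  rw [map_sub, sub_add_cancel]

/-- `S_{k+1} ⋯ S_{k+l} (κ^(k+l) ∘ η^(k+l))`. -/
def BQFS.compApprox (η : BQFS R Λ Ω) (κ : BQFS R Ω Ξ) (k l : ℕ) : NT Λ Ξ k :=
  loopIter R Λ Ξ k l (η.seq (k + l) ≫ κ.seq (k + l))

/-- By `inner_phi_loopIter` the loops do not change scalar products at level `k`, so these are the
scalar products of `κ.op (k + l)` after `η.op (k + l)`. -/
theorem BQFS.tendsto_inner_compApprox (η : BQFS R Λ Ω) (κ : BQFS R Ω Ξ) (k : ℕ)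
    (ξ : Δ.obj k ⟶ (Λ.F k).obj (Γ.obj k)) (ζ : Δ.obj k ⟶ (Ξ.F k).obj (Γ.obj k)) :
    Filter.Tendsto (fun l => inner ℂ (Ξ.ι k ζ)
      (OneCell.phi k ((compApprox η κ k l).app (Γ.obj k)) (Λ.ι k ξ))) Filter.atTop
      (nhds (inner ℂ (Ξ.ι k ζ) ((κ.PB ∘L η.PB) (Λ.ι k ξ)))) := by
  have h := (tendsto_op_op η κ (Λ.ι k ξ)).comp (Filter.tendsto_atTop_mono
    (fun l => Nat.le_add_left l k) Filter.tendsto_id)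
  refine (tendsto_const_nhds.inner h).congr fun l => ?_
  rw [compApprox, inner_phi_loopIter, phi_comp (k + l) _ _ (Nat.le_add_right k l)]
  rfl

theorem BQFS.exists_comp (η : BQFS R Λ Ω) (κ : BQFS R Ω Ξ) :
    ∃ ψ : BQFS R Λ Ξ, (∀ k, NTTendsto (compApprox η κ k) (ψ.seq k)) ∧
      ψ.PB = κ.PB ∘L η.PB := by
  choose ψ hψ using fun k => exists_NTTendsto
    (cauchySeq_app_simple (T := κ.PB ∘L η.PB) (tendsto_inner_compApprox η κ k))
  -- `ψ k` is the compression of the product operator to level `k`; quasi-flatness and the product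
  -- formula both come from this.
  have hin : ∀ k ξ ζ, inner ℂ (Ξ.ι k ζ) (OneCell.phi k ((ψ k).app (Γ.obj k)) (Λ.ι k ξ)) =
      inner ℂ (Ξ.ι k ζ) ((κ.PB ∘L η.PB) (Λ.ι k ξ)) := fun k ξ ζ =>
    tendsto_nhds_unique (tendsto_const_nhds.inner ((hψ k).tendsto_phi ξ))
      (tendsto_inner_compApprox η κ k ξ ζ)
  have hb : ∃ c : ℝ, ∀ k X, ‖(ψ k).app X‖ ≤ c := by
    obtain ⟨c₁, h₁⟩ := η.bounded
    obtain ⟨c₂, h₂⟩ := κ.bounded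
    -- Loops are contractive, so the bound on `κ ∘ η` passes to the approximants and then to the
    -- limit.
    refine ⟨c₁ * c₂, fun k X => ?_⟩
    refine le_of_tendsto ((hψ k).tendsto_app X).norm (Filter.Eventually.of_forall fun l => ?_)
    refine norm_loopIter_app_le R k l _ (fun Y => ?_) X
    exact (norm_comp_le _ _).trans (mul_le_mul (h₁ _ _) (h₂ _ _) (norm_nonneg _)
      ((norm_nonneg _).trans (h₁ _ Y)))
  let Ψ : BQFS R Λ Ξ :=
    { seq := ψ
      quasiFlat := fun k => NT_ext fun ξ ζ => by
        -- Viewed in level `k + 1`, the vectors of level `k` test the same operator, so the two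
        -- compressions agree.
        rw [inner_phi_loop, hin, ← Λ.ι_incl, ← Ξ.ι_incl, hin]
      bounded := hb }
  refine ⟨Ψ, hψ, DFunLike.coe_injective (HilbertTower.eq_of_forall_level (S := Λ.tower)
    Ψ.PB.continuous (κ.PB ∘L η.PB).continuous 0 fun m _ ξ => ?_)⟩
  -- At each level `n ≥ m`, both operators have the scalar products of `Φ_{ψ n}`, by `inner_PB` and
  -- `hin`.
  refine HilbertTower.eq_of_inner_level (S := Ξ.tower) m fun n hn ζ => ?_
  obtain ⟨ξ', hξ⟩ := Λ.exists_ι_of_le hn ξ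
  have := (Ψ.inner_PB n ξ' ζ).trans (hin n ξ' ζ)
  rwa [hξ] at this

end Coefficients

end

theorem mainTheorem7 {Γ : ZeroCell.{v₁, u₁}} {Δ : ZeroCell.{v₂, u₂}} (R : Solutions Δ)
    (Λ Ω Ξ : OneCell Γ Δ) (η : BQFS R Λ Ω) (κ : BQFS R Ω Ξ) :
    ∃ ψ : BQFS R Λ Ξ,
      (∀ k : ℕ, NTTendsto (fun l : ℕ =>
        loopIter R Λ Ξ k l (η.seq (k + l) ≫ κ.seq (k + l))) (ψ.seq k)) ∧
      (η.IsLimit η.PB ∧ OneCell.IsBimoduleMap η.PB) ∧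
      (κ.IsLimit κ.PB ∧ OneCell.IsBimoduleMap κ.PB) ∧
      (ψ.IsLimit ψ.PB ∧ OneCell.IsBimoduleMap ψ.PB) ∧
      ψ.PB = κ.PB ∘L η.PB := by
  obtain ⟨ψ, hψ, hPB⟩ := BQFS.exists_comp η κ
  exact ⟨ψ, hψ, ⟨η.isLimit_PB, η.isBimoduleMap_PB⟩, ⟨κ.isLimit_PB, κ.isBimoduleMap_PB⟩,
    ⟨ψ.isLimit_PB, ψ.isBimoduleMap_PB⟩, hPB⟩
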